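/- **Setting.** For $T\ge 0$ and $v\in\mathbb{R}^3_+$, let $(x,y,z)$ be continuous functions $[0,\infty)\to\mathbb{R}^3$ such that $x(0)=0$, $x$ is absolutely continuous with derivative square integrable on bounded intervals, $z(t)=x(t)+Ry(t)\ge 0$ for all $t\ge0$, $y(0)=0$, each $y_i$ is nondecreasing with $\int_0^\infty z_i\,dy_i=0$, and $z(T)=v$. Let $$I(v)=\inf \tfrac12\int_0^T\|\dot x(t)-\theta\|^2\,dt ,\qquad \|u\|^2=u'\Gamma^{-1}u,$$ the infimum being over all $T\ge0$ and all such triples. If the infimum is attained by $T$ and $(x,y,z)$, then $z$, considered on $[0,T]$, is called an *optimal path* to $v$. It has $n$ segments if there are times $0=\tau_0<\tau_1<\dots<\tau_n=T$ such that $z$ moves with a constant nonzero velocity on each $[\tau_{k-1},\tau_k]$. For $K\subset\{1,2,3\}$ let $F_K=\{v\in\mathbb{R}^3_+ : v_i=0 \text{ for } i\in K\}$, a face of dimension $3-|K|$; it is an axis if $|K|=2$ and a two-dimensional face if $|K|=1$. A path with $n$ segments is *gradual* if there are faces $F_{K_1},\dots,F_{K_n}$ of strictly increasing dimension such that $z(t)$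 lies in the relative interior of $F_{K_k}$ for all $t\in(\tau_{k-1},\tau_k]$, $k=1,\dots,n$. (So a path that leaves an axis and crosses the interior of the octant to a point of a two-dimensional face is not gradual.) **Theorem.** Let the data $(\theta,\Gamma,R)$ be rotationally symmetric with $\Gamma=I$, that is, $\theta=(\theta_0,\theta_0,\theta_0)'$ and $$R=\begin{pmatrix}1&r_2&r_1\\ r_1&1&r_2\\ r_2&r_1&1\end{pmatrix}.$$ Assume $\theta_0<0$, $r_1,r_2\ge0$, and Condition 1: $r_1>r_2$, $-1<r_1+r_2<2$ and $$(1+r_2^2)(1+r_1^2-r_2-r_1r_2)^2\ \ge\ 2(r_1r_2)^2(1+r_1^2+r_2^2-r_1-r_2-r_1r_2).$$ Let $v\neq0$ be a point to which there exists an optimal path with a finite number of segments. Then: (i) if $v$ lies on an axis, there exists an optimal path to $v$ consisting of a single segment; (ii) if $v$ lies on a two-dimensional face, there exists a gradual optimal path to $v$ consisting of one or two segments. -/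

import Mathlib

open Set MeasureTheory

noncomputable section

namespace SRBM

/-- The squared norm `‖v‖² = ⟨v, v⟩ = v' Γ⁻¹ v`. -/
def normSq {d : ℕ} (Γ : Matrix (Fin d) (Fin d) ℝ) (v : Fin d → ℝ) : ℝ :=
  dotProduct v (Γ⁻¹.mulVec v)

/-- A function that is nondecreasing on `[0, ∞)`, extended to the left by its value at `0`. -/
theorem monotone_extend {f : ℝ → ℝ} (hf : MonotoneOn f (Ici 0)) :
    Monotone (fun t => f (max t 0)) := fun a b h =>
  hf (show (0 : ℝ) ≤ max a 0 from le_max_right a 0) (show (0 : ℝ) ≤ max b 0 from le_max_right b 0)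
    (max_le_max_right 0 h)

/-- The Lebesgue-Stieltjes measure `df` on `ℝ` of a function `f` that is nondecreasing on `[0, ∞)`;
the extension of `f` is constant on `(-∞, 0]`, so that for continuous `f` all the mass is on
`(0, ∞)`. -/
def stieltjesMeasure {f : ℝ → ℝ} (hf : MonotoneOn f (Ici 0)) : Measure ℝ :=
  (monotone_extend hf).stieltjesFunction.measure

/-- The Skorohod problem: `(z, y)` is an `R`-regulation of the path `x`. Paths are functions of a
real time variable of which only the restriction to `[0, ∞)` matters. -/
structure IsRegulation {d : ℕ} (R : Matrix (Fin d) (Fin d) ℝ) (x y z : ℝ → Fin d → ℝ) : Prop where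
  continuousOn_x : ContinuousOn x (Ici 0)
  continuousOn_y : ContinuousOn y (Ici 0)
  continuousOn_z : ContinuousOn z (Ici 0)
  eq_add : ∀ t, 0 ≤ t → z t = x t + R.mulVec (y t)
  nonneg : ∀ t, 0 ≤ t → 0 ≤ z t
  monotone : ∀ i, MonotoneOn (fun t => y t i) (Ici 0)
  zero : y 0 = 0
  /-- `∫₀^∞ z_i dy_i = 0`; the integrand is nonnegative, so the integral is taken in `[0, ∞]`. -/
  integral_eq_zero : ∀ i, ∫⁻ s in Ici 0, ENNReal.ofReal (z s i) ∂(stieltjesMeasure (monotone i)) = 0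

/-- The space `ℋ^d`: absolutely continuous functions on `[0, ∞)` with square integrable derivative
on bounded intervals, started at the origin. -/
structure MemH {d : ℕ} (x : ℝ → Fin d → ℝ) : Prop where
  absolutelyContinuous : ∀ T, 0 ≤ T → AbsolutelyContinuousOnInterval x 0 T
  memLp_deriv : ∀ T, 0 ≤ T → MemLp (deriv x) 2 (volume.restrict (Ioc 0 T))
  zero : x 0 = 0

/-- The cost `½ ∫₀ᵀ ‖ẋ(t) - θ‖² dt`. -/
def cost {d : ℕ} (θ : Fin d → ℝ) (Γ : Matrix (Fin d) (Fin d) ℝ) (x : ℝ → Fin d → ℝ) (T : ℝ) : ℝ :=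
  (1 / 2) * ∫ t in (0 : ℝ)..T, normSq Γ (deriv x t - θ)

/-- `(x, y, z)` solves the Skorohod problem with `x ∈ ℋ^d`, and `z` is at `v` at time `T ≥ 0`. -/
structure IsFeasible {d : ℕ} (R : Matrix (Fin d) (Fin d) ℝ) (v : Fin d → ℝ) (T : ℝ)
    (x y z : ℝ → Fin d → ℝ) : Prop where
  time_nonneg : 0 ≤ T
  memH : MemH x
  isRegulation : IsRegulation R x y z
  terminal : z T = v

/-- The value `I(v)` of the variational problem. -/
def value {d : ℕ} (θ : Fin d → ℝ) (Γ R : Matrix (Fin d) (Fin d) ℝ) (v : Fin d → ℝ) : ℝ :=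
  sInf {c : ℝ | ∃ (T : ℝ) (x y z : ℝ → Fin d → ℝ), IsFeasible R v T x y z ∧ c = cost θ Γ x T}

/-- `(x, y, z)` is an optimal triple for the terminal point `v`, with optimal time `T`. -/
def IsOptimalTriple {d : ℕ} (θ : Fin d → ℝ) (Γ R : Matrix (Fin d) (Fin d) ℝ) (v : Fin d → ℝ)
    (T : ℝ) (x y z : ℝ → Fin d → ℝ) : Prop :=
  IsFeasible R v T x y z ∧ cost θ Γ x T = value θ Γ R v

/-- `z` is an optimal path to `v`, with optimal time `T`. -/
def IsOptimalPath {d : ℕ} (θ : Fin d → ℝ) (Γ R : Matrix (Fin d) (Fin d) ℝ) (v : Fin d → ℝ)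
    (T : ℝ) (z : ℝ → Fin d → ℝ) : Prop :=
  ∃ x y : ℝ → Fin d → ℝ, IsOptimalTriple θ Γ R v T x y z

/-- The face `F_K` of the orthant. -/
def face {d : ℕ} (K : Finset (Fin d)) : Set (Fin d → ℝ) :=
  {v | 0 ≤ v ∧ ∀ i ∈ K, v i = 0}

/-- On `[0, T]` the path `z` consists of the `n` (nondegenerate) linear segments with break times
`0 = τ 0 < τ 1 < ⋯ < τ n = T`. -/
structure IsSegmentation {d : ℕ} (z : ℝ → Fin d → ℝ) (T : ℝ) (n : ℕ) (τ : Fin (n + 1) → ℝ) :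
    Prop where
  first : τ 0 = 0
  last : τ (Fin.last n) = T
  strictMono : StrictMono τ
  linear : ∀ k : Fin n, ∃ u : Fin d → ℝ, u ≠ 0 ∧
    ∀ t ∈ Icc (τ k.castSucc) (τ k.succ), z t = z (τ k.castSucc) + (t - τ k.castSucc) • u

/-- On `[0, T]` the path `z` consists of `n` linear segments. -/
def HasSegments {d : ℕ} (z : ℝ → Fin d → ℝ) (T : ℝ) (n : ℕ) : Prop :=
  ∃ τ : Fin (n + 1) → ℝ, IsSegmentation z T n τ

/-- On `[0, T]` the path `z` is gradual with `n` linear segments: after its starting point, the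
`k`-th segment (endpoint included) lies in the relative interior of a face `F_{K k}`, and the
dimensions `d - |K k|` of these faces are strictly increasing. Since the endpoint is included, no
segment may cross the interior of the orthant to a point of a proper face. -/
def IsGradual {d : ℕ} (z : ℝ → Fin d → ℝ) (T : ℝ) (n : ℕ) : Prop :=
  ∃ (τ : Fin (n + 1) → ℝ) (K : Fin n → Finset (Fin d)), IsSegmentation z T n τ ∧
    (∀ k : Fin n, ∀ t ∈ Ioc (τ k.castSucc) (τ k.succ), z t ∈ face (K k) ∧ ∀ i ∉ K k, 0 < z t i) ∧
    StrictMono (fun k : Fin n => d - (K k).card)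

/-- Rotationally symmetric data `(θ, Γ, R)` in dimension three. -/
structure IsRotationallySymmetric (θ₀ r₁ r₂ : ℝ) (θ : Fin 3 → ℝ)
    (Γ R : Matrix (Fin 3) (Fin 3) ℝ) : Prop where
  reflection : R = !![1, r₂, r₁; r₁, 1, r₂; r₂, r₁, 1]
  drift : θ = ![θ₀, θ₀, θ₀]
  covariance : ∃ σ ρ : ℝ, -1 < ρ ∧ ρ < 1 ∧
    Γ = !![σ ^ 2, ρ * σ ^ 2, ρ * σ ^ 2; ρ * σ ^ 2, σ ^ 2, ρ * σ ^ 2; ρ * σ ^ 2, ρ * σ ^ 2, σ ^ 2]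
  posDef : Γ.PosDef

/-- The region `R_f` of reflection parameters. -/
def regionRf : Set (ℝ × ℝ) :=
  {r | 0 ≤ r.1 ∧ 0 ≤ r.2 ∧ r.2 < r.1 ∧ -1 < r.1 + r.2 ∧ r.1 + r.2 < 2}

/-- Condition 1 on the reflection parameters. -/
def Condition1 (r₁ r₂ : ℝ) : Prop :=
  (r₁, r₂) ∈ regionRf ∧
    2 * (r₁ * r₂) ^ 2 * (1 + r₁ ^ 2 + r₂ ^ 2 - r₁ - r₂ - r₁ * r₂) ≤
      (1 + r₂ ^ 2) * (1 + r₁ ^ 2 - r₂ - r₁ * r₂) ^ 2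

end SRBM

end

/-! The proof is by convex duality. The drift is `-κ(1,1,1)` with `κ > 0`. Completing a square shows
that a linear functional `q` with `|q|² + 2 q·θ ≤ 0` satisfies `q·ẋ ≤ ½|ẋ - θ|²`. If also `q·R_i ≤
0` for every coordinate `i` that vanishes along a linear segment of `z`, the segment costs at least
the increment of `q·z`. A function whose increments are dominated by such functionals is a
subsolution. It bounds the cost of all paths with finitely many segments (`IsSubsolution.le_cost`),
hence the value, because an optimal path of this kind is given. Conversely, velocities conjugate to
a point of the sphere attain the bound (`IsReached.move`).

After division by `κ`, `q` ranges over the ball with centre `(1,1,1)` through the origin. An axis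
has a dual point `p` on the sphere, orthogonal to the two reflections acting there; `p₁` is the cost
per unit length of a direct move along the axis. The rival is a spiral through the faces, whose
limiting cost per unit length is `α`. By `exists_axis_dual`, `α - p₁` has the sign of `1 - r`.

If `r ≤ 1`, axial moves, followed if necessary by one segment in a face, match a subsolution built
from `p` and two further points of the sphere (`exists_axis_optimal`, `exists_face_optimal`).

If `r > 1`, the limiting spiral cost is a subsolution, and finite spirals approach it. Every first
segment out of the origin costs strictly more than its increment, so no optimal path to the boundary
has finitely many segments (`not_isOptimalPath_of_one_lt`), and the claim is vacuous. -/

namespace SRBM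

/-! ### Complementarity: `∫ z dy = 0` means that `y` is constant where `z > 0`. -/

section Stieltjes

theorem continuous_extend {f : ℝ → ℝ} (hf : ContinuousOn f (Ici 0)) :
    Continuous (fun t => f (max t 0)) :=
  hf.comp_continuous (by fun_prop) fun t => le_max_right t 0

theorem stieltjesMeasure_Ioc {f : ℝ → ℝ} (hf : MonotoneOn f (Ici 0))
    (hc : ContinuousOn f (Ici 0)) (s t : ℝ) :
    stieltjesMeasure hf (Ioc s t) = ENNReal.ofReal (f (max t 0) - f (max s 0)) := by
  have key : ∀ u, (monotone_extend hf).stieltjesFunction u = f (max u 0) := fun u => by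
    rw [Monotone.stieltjesFunction_eq]
    exact (continuous_extend hc).continuousAt.continuousWithinAt.rightLim_eq
  rw [stieltjesMeasure, StieltjesFunction.measure_Ioc, key, key]

/-- If `∫₀^∞ z dy = 0`, then `y` does not grow on intervals on which `z` is positive. -/
theorem eq_of_lintegral_eq_zero {y z : ℝ → ℝ} (hy : MonotoneOn y (Ici 0))
    (hyc : ContinuousOn y (Ici 0)) (hz : ContinuousOn z (Ici 0))
    (h : ∫⁻ u in Ici 0, ENNReal.ofReal (z u) ∂(stieltjesMeasure hy) = 0) {s t : ℝ} (hs : 0 ≤ s)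
    (hst : s ≤ t) (hpos : ∀ u ∈ Icc s t, 0 < z u) : y t = y s := by
  have hsub : Icc s t ⊆ Ici 0 := fun u hu => hs.trans hu.1
  obtain ⟨m, hm, hmin⟩ := isCompact_Icc.exists_isMinOn (nonempty_Icc.2 hst) (hz.mono hsub)
  have hle : ENNReal.ofReal (z m) * stieltjesMeasure hy (Ioc s t) ≤ 0 := by
    rw [← h, ← setLIntegral_const]
    calc ∫⁻ _ in Ioc s t, ENNReal.ofReal (z m) ∂(stieltjesMeasure hy)
        ≤ ∫⁻ u in Ioc s t, ENNReal.ofReal (z u) ∂(stieltjesMeasure hy) :=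
          setLIntegral_mono' measurableSet_Ioc fun u hu =>
            ENNReal.ofReal_le_ofReal (hmin (Ioc_subset_Icc_self hu))
      _ ≤ _ := lintegral_mono_set (Ioc_subset_Icc_self.trans hsub)
  have h0 : stieltjesMeasure hy (Ioc s t) = 0 := by
    rcases mul_eq_zero.1 (le_antisymm hle bot_le) with h1 | h1
    · exact absurd (ENNReal.ofReal_eq_zero.1 h1) (not_le.2 (hpos m hm))
    · exact h1
  rw [stieltjesMeasure_Ioc hy hyc, max_eq_left hs, max_eq_left (hs.trans hst),
    ENNReal.ofReal_eq_zero] at h0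
  exact le_antisymm (by linarith) (hy hs (hs.trans hst) hst)

/-- A segment may start or end on a face, so positivity is available only between the endpoints;
continuity of `y` closes the interval. -/
theorem eq_of_lintegral_eq_zero_of_Ioo {y z : ℝ → ℝ} (hy : MonotoneOn y (Ici 0))
    (hyc : ContinuousOn y (Ici 0)) (hz : ContinuousOn z (Ici 0))
    (h : ∫⁻ u in Ici 0, ENNReal.ofReal (z u) ∂(stieltjesMeasure hy) = 0) {s t : ℝ} (hs : 0 ≤ s)
    (hst : s < t) (hpos : ∀ u ∈ Ioo s t, 0 < z u) : y t = y s := by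
  set m := (s + t) / 2 with hm
  have hsub : Icc s t ⊆ Ici 0 := fun u hu => hs.trans hu.1
  have hconst : EqOn y (fun _ => y m) (Ioo s t) := by
    intro u hu
    rcases le_total u m with hum | hum
    · exact (eq_of_lintegral_eq_zero hy hyc hz h (hs.trans hu.1.le) hum fun v hv =>
        hpos v ⟨hu.1.trans_le hv.1, hv.2.trans_lt (by linarith)⟩).symm
    · exact eq_of_lintegral_eq_zero hy hyc hz h (by linarith) hum fun v hv =>
        hpos v ⟨by linarith [hv.1], hv.2.trans_lt hu.2⟩
  have hconst' : EqOn y (fun _ => y m) (Icc s t) :=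
    hconst.of_subset_closure (hyc.mono hsub) continuousOn_const Ioo_subset_Icc_self
      (by rw [closure_Ioo hst.ne])
  rw [hconst' (right_mem_Icc.2 hst.le), hconst' (left_mem_Icc.2 hst.le)]

/-- If `y` is constant on the intervals on which `z` is positive, then `∫₀^∞ z dy = 0`. -/
theorem lintegral_eq_zero_of_eq {y z : ℝ → ℝ} (hy : MonotoneOn y (Ici 0))
    (hyc : ContinuousOn y (Ici 0)) (hz : ContinuousOn z (Ici 0))
    (h : ∀ s t, 0 ≤ s → s ≤ t → (∀ u ∈ Icc s t, 0 < z u) → y t = y s) :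
    ∫⁻ u in Ici 0, ENNReal.ofReal (z u) ∂(stieltjesMeasure hy) = 0 := by
  have hnull : stieltjesMeasure hy {t | 0 ≤ t ∧ 0 < z t} = 0 := by
    refine measure_null_of_locally_null _ fun t ht => ?_
    have hev : ∀ᶠ u in nhdsWithin t (Ici 0), 0 < z u :=
      (hz t ht.1).eventually (lt_mem_nhds ht.2)
    obtain ⟨ε, hε, hball⟩ := Metric.mem_nhdsWithin_iff.1 hev
    refine ⟨Ioc (t - ε / 2) (t + ε / 2), mem_nhdsWithin_of_mem_nhds
      (Ioc_mem_nhds (by linarith) (by linarith)), ?_⟩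
    rw [stieltjesMeasure_Ioc hy hyc, h (max (t - ε / 2) 0) (max (t + ε / 2) 0) (le_max_right _ _)
      (max_le_max_right 0 (by linarith)) ?_, sub_self, ENNReal.ofReal_zero]
    intro u hu
    have h0 : 0 ≤ u := (le_max_right _ _).trans hu.1
    have h1 : t - ε / 2 ≤ u := (le_max_left _ _).trans hu.1
    have h2 : u ≤ t + ε / 2 := hu.2.trans_eq (max_eq_left (by linarith [ht.1]))
    refine hball ⟨?_, h0⟩
    rw [Metric.mem_ball, Real.dist_eq, abs_lt]
    constructor <;> linarith
  refine lintegral_eq_zero_of_ae_eq_zero ?_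
  rw [Filter.EventuallyEq, ae_restrict_iff' measurableSet_Ici]
  filter_upwards [compl_mem_ae_iff.2 hnull] with t ht ht0
  have : ¬ (0 < z t) := fun hh => ht ⟨ht0, hh⟩
  simpa using this

end Stieltjes

/-! ### Weak duality: subsolutions bound the cost from below. -/

section LowerBound

variable {d : ℕ}

theorem normSq_one (v : Fin d → ℝ) : normSq 1 v = v ⬝ᵥ v := by
  simp [normSq]

/-- The running cost dominates every linear functional in the polar ball of the drift. -/
theorem dotProduct_le_half_normSq {θ q : Fin d → ℝ} (hq : q ⬝ᵥ q + 2 * (q ⬝ᵥ θ) ≤ 0)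
    (u : Fin d → ℝ) : q ⬝ᵥ u ≤ 1 / 2 * normSq 1 (u - θ) := by
  rw [normSq_one]
  have h : 0 ≤ (u - θ - q) ⬝ᵥ (u - θ - q) := by
    simpa using dotProduct_star_self_nonneg (u - θ - q)
  have e : (u - θ - q) ⬝ᵥ (u - θ - q) =
      (u - θ) ⬝ᵥ (u - θ) - 2 * (q ⬝ᵥ u) + 2 * (q ⬝ᵥ θ) + q ⬝ᵥ q := by
    simp only [sub_dotProduct, dotProduct_sub, dotProduct_comm u q, dotProduct_comm θ q]
    ring
  linarith

variable {x : ℝ → Fin d → ℝ}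

theorem absolutelyContinuousOnInterval_apply {a b : ℝ} (hx : AbsolutelyContinuousOnInterval x a b)
    (i : Fin d) : AbsolutelyContinuousOnInterval (fun t => x t i) a b := by
  refine squeeze_zero (fun t => Finset.sum_nonneg fun i _ => dist_nonneg) (fun t => ?_) hx
  exact Finset.sum_le_sum fun j _ => dist_le_pi_dist _ _ i

theorem absolutelyContinuousOnInterval_dotProduct {a b : ℝ}
    (hx : AbsolutelyContinuousOnInterval x a b) (q : Fin d → ℝ) :
    AbsolutelyContinuousOnInterval (fun t => q ⬝ᵥ x t) a b := by
  have key : ∀ s : Finset (Fin d),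
      AbsolutelyContinuousOnInterval (fun t => ∑ i ∈ s, q i * x t i) a b := by
    intro s
    induction s using Finset.induction_on with
    | empty =>
      simpa using ((LipschitzWith.const (α := ℝ) (0 : ℝ)).lipschitzOnWith
        (s := uIcc a b)).absolutelyContinuousOnInterval
    | insert i s hi ih =>
      simp only [Finset.sum_insert hi]
      exact (AbsolutelyContinuousOnInterval.const_mul (q i)
        (absolutelyContinuousOnInterval_apply hx i)).add ih
  exact key Finset.univ

theorem ae_deriv_dotProduct_eq {a b : ℝ}
    (hx : AbsolutelyContinuousOnInterval x a b) (q : Fin d → ℝ) :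
    ∀ᵐ t : ℝ, t ∈ uIcc a b → deriv (fun t => q ⬝ᵥ x t) t = q ⬝ᵥ deriv x t := by
  have h : ∀ᵐ t : ℝ, ∀ i, t ∈ uIcc a b → DifferentiableAt ℝ (fun t => x t i) t :=
    ae_all_iff.2 fun i => (absolutelyContinuousOnInterval_apply hx i).ae_differentiableAt
  filter_upwards [h] with t ht htu
  have hd : HasDerivAt x (deriv x t) t :=
    (differentiableAt_pi.2 fun i => ht i htu).hasDerivAt
  rw [hasDerivAt_pi] at hd
  exact (HasDerivAt.fun_sum fun i _ => (hd i).const_mul (q i)).deriv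

theorem MemH.intervalIntegrable (hx : MemH x) (θ : Fin d → ℝ) {s t : ℝ} (hs : 0 ≤ s)
    (hst : s ≤ t) : IntervalIntegrable (fun u => normSq 1 (deriv x u - θ)) volume s t := by
  have hL : MemLp (fun u => deriv x u - θ) 2 (volume.restrict (Ioc s t)) :=
    ((hx.memLp_deriv t (hs.trans hst)).mono_measure
      (Measure.restrict_mono (Ioc_subset_Ioc_left hs) le_rfl)).sub (memLp_const θ)
  rw [intervalIntegrable_iff_integrableOn_Ioc_of_le hst]
  simp only [normSq_one, dotProduct]
  refine integrable_finsetSum _ fun i _ => ?_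
  have hi : MemLp (fun u => (deriv x u - θ) i) 2 (volume.restrict (Ioc s t)) :=
    (memLp_pi_iff.1 hL) i
  exact hi.integrable_mul hi

theorem MemH.dotProduct_sub_le (hx : MemH x) {θ q : Fin d → ℝ} (hq : q ⬝ᵥ q + 2 * (q ⬝ᵥ θ) ≤ 0)
    {s t : ℝ} (hs : 0 ≤ s) (hst : s ≤ t) :
    q ⬝ᵥ (x t - x s) ≤ 1 / 2 * ∫ u in s..t, normSq 1 (deriv x u - θ) := by
  have hac : AbsolutelyContinuousOnInterval x s t := (hx.absolutelyContinuous t (hs.trans hst)).mono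
    (by rw [uIcc_of_le hst, uIcc_of_le (hs.trans hst)]; exact Icc_subset_Icc_left hs)
  have hac' := absolutelyContinuousOnInterval_dotProduct hac q
  rw [dotProduct_sub, ← hac'.integral_deriv_eq_sub, ← intervalIntegral.integral_const_mul]
  refine intervalIntegral.integral_mono_ae_restrict hst hac'.intervalIntegrable_deriv
    ((hx.intervalIntegrable θ hs hst).const_mul _) ?_
  rw [Filter.EventuallyLE, ae_restrict_iff' measurableSet_Icc]
  filter_upwards [ae_deriv_dotProduct_eq hac q] with u hu hu'
  rw [hu (by rwa [uIcc_of_le hst])]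
  exact dotProduct_le_half_normSq hq _

variable {y z : ℝ → Fin d → ℝ} {R : Matrix (Fin d) (Fin d) ℝ} {θ : Fin d → ℝ}

theorem IsRegulation.apply_eq (h : IsRegulation R x y z) (i : Fin d) {s t : ℝ} (hs : 0 ≤ s)
    (hst : s < t) (hpos : ∀ u ∈ Ioo s t, 0 < z u i) : y t i = y s i :=
  eq_of_lintegral_eq_zero_of_Ioo (h.monotone i) (continuousOn_pi.1 h.continuousOn_y i)
    (continuousOn_pi.1 h.continuousOn_z i) (h.integral_eq_zero i) hs hst hpos

theorem IsRegulation.initial (h : IsRegulation R x y z) (hx : MemH x) : z 0 = 0 := by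
  rw [h.eq_add 0 le_rfl, hx.zero, h.zero]; simp

/-- The linear functional `q` is a lower bound for the cost of moves within the face of the points
whose coordinates `i` with `a i = b i = 0` vanish. -/
structure IsAdmissible (θ : Fin d → ℝ) (R : Matrix (Fin d) (Fin d) ℝ) (a b q : Fin d → ℝ) :
    Prop where
  polar : q ⬝ᵥ q + 2 * (q ⬝ᵥ θ) ≤ 0
  reflection : ∀ i, a i = 0 → b i = 0 → q ⬝ᵥ R.col i ≤ 0

/-- The increment of `z` is that of `x` plus `R` times that of `y`. A coordinate that does not
vanish at both ends is positive in between, so its `y i` does not grow; the other pushes contribute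
a nonpositive amount to `q`. -/
theorem dotProduct_sub_le_of_linear (h : IsRegulation R x y z) (hx : MemH x) {q : Fin d → ℝ}
    {s t : ℝ} (hs : 0 ≤ s) (hst : s < t) (hq : IsAdmissible θ R (z s) (z t) q) {u : Fin d → ℝ}
    (hlin : ∀ r ∈ Icc s t, z r = z s + (r - s) • u) :
    q ⬝ᵥ (z t - z s) ≤ 1 / 2 * ∫ u in s..t, normSq 1 (deriv x u - θ) := by
  have ht : 0 ≤ t := hs.trans hst.le
  refine le_trans ?_ (hx.dotProduct_sub_le hq.polar hs hst.le)
  have hsum : q ⬝ᵥ (R.mulVec (y t - y s)) ≤ 0 := by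
    rw [Matrix.mulVec_eq_sum, dotProduct_sum]
    refine Finset.sum_nonpos fun i _ => ?_
    rw [show (MulOpposite.op ((y t - y s) i) • R.transpose i) = (y t i - y s i) • R.col i from by
      ext j; simp [mul_comm], dotProduct_smul, smul_eq_mul]
    have hmono : 0 ≤ y t i - y s i := sub_nonneg.2 (h.monotone i hs ht hst.le)
    by_cases hi : z s i = 0 ∧ z t i = 0
    · exact mul_nonpos_of_nonneg_of_nonpos hmono (hq.reflection i hi.1 hi.2)
    · rw [h.apply_eq i hs hst, sub_self, zero_mul]
      intro r hr
      have e1 := congrFun (hlin r (Ioo_subset_Icc_self hr)) i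
      have e2 := congrFun (hlin t (right_mem_Icc.2 hst.le)) i
      simp only [Pi.add_apply, Pi.smul_apply, smul_eq_mul] at e1 e2
      have n1 : 0 ≤ z s i := h.nonneg s hs i
      have n2 : 0 ≤ z t i := h.nonneg t ht i
      have e3 : (t - s) * z r i = (t - r) * z s i + (r - s) * z t i := by rw [e1, e2]; ring
      have h1 : 0 < t - r := sub_pos.2 hr.2
      have h2 : 0 < r - s := sub_pos.2 hr.1
      refine pos_of_mul_pos_right (a := t - s) ?_ (by linarith)
      rw [e3]
      rcases n1.lt_or_eq with hlt | heq
      · have := mul_pos h1 hlt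
        have := mul_nonneg h2.le n2
        linarith
      · have hlt := lt_of_le_of_ne n2 fun hh => hi ⟨heq.symm, hh.symm⟩
        have := mul_pos h2 hlt
        have := mul_nonneg h1.le n1
        linarith
  have e : z t - z s = (x t - x s) + R.mulVec (y t - y s) := by
    rw [h.eq_add t ht, h.eq_add s hs, Matrix.mulVec_sub]; abel
  rw [e, dotProduct_add]
  linarith

/-- A function whose increments along linear moves are lower bounds for the cost. -/
def IsSubsolution (θ : Fin d → ℝ) (R : Matrix (Fin d) (Fin d) ℝ) (V : (Fin d → ℝ) → ℝ) : Prop :=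
  ∀ a b, 0 ≤ a → 0 ≤ b → ∃ q, IsAdmissible θ R a b q ∧ V b - V a ≤ q ⬝ᵥ (b - a)

theorem IsSegmentation.nonneg {T : ℝ} {n : ℕ} {τ : Fin (n + 1) → ℝ} (h : IsSegmentation z T n τ)
    (k : Fin (n + 1)) : 0 ≤ τ k :=
  h.first ▸ h.strictMono.monotone (Fin.zero_le k)

theorem IsSubsolution.le_integral {V : (Fin d → ℝ) → ℝ} (hV : IsSubsolution θ R V)
    (h : IsRegulation R x y z) (hx : MemH x) {T : ℝ} {n : ℕ} {τ : Fin (n + 1) → ℝ}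
    (hτ : IsSegmentation z T n τ) (j k : Fin (n + 1)) (hjk : j ≤ k) :
    V (z (τ k)) - V (z (τ j)) ≤ 1 / 2 * ∫ u in τ j..τ k, normSq 1 (deriv x u - θ) := by
  induction k using Fin.induction with
  | zero =>
    obtain rfl : j = 0 := le_antisymm hjk (Fin.zero_le j)
    simp
  | succ i ih =>
    rcases hjk.lt_or_eq with hlt | rfl
    · have hji : j ≤ i.castSucc := Fin.le_castSucc_iff.2 hlt
      have hlt' : τ i.castSucc < τ i.succ := hτ.strictMono Fin.castSucc_lt_succ
      obtain ⟨u, -, hlin⟩ := hτ.linear i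
      obtain ⟨q, hq, hVq⟩ := hV (z (τ i.castSucc)) (z (τ i.succ)) (h.nonneg _ (hτ.nonneg _))
        (h.nonneg _ (hτ.nonneg _))
      have h1 := dotProduct_sub_le_of_linear h hx (hτ.nonneg _) hlt' hq hlin
      rw [← intervalIntegral.integral_add_adjacent_intervals
        (hx.intervalIntegrable θ (hτ.nonneg j) (hτ.strictMono.monotone hji))
        (hx.intervalIntegrable θ (hτ.nonneg i.castSucc) hlt'.le)]
      linarith [ih hji]
    · simp

/-- Subsolutions bound the cost of paths with finitely many segments from below. -/
theorem IsSubsolution.le_cost {V : (Fin d → ℝ) → ℝ} (hV : IsSubsolution θ R V) (hV0 : V 0 = 0)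
    {v : Fin d → ℝ} {T : ℝ} (h : IsFeasible R v T x y z) {n : ℕ} (hn : HasSegments z T n) :
    V v ≤ cost θ 1 x T := by
  obtain ⟨τ, hτ⟩ := hn
  have := hV.le_integral h.isRegulation h.memH hτ 0 (Fin.last n) (Fin.zero_le _)
  rw [hτ.first, hτ.last, h.terminal, h.isRegulation.initial h.memH, hV0, sub_zero] at this
  exact this

/-- A subsolution that is not attained by any first segment is a strict lower bound. -/
theorem IsSubsolution.lt_cost {V : (Fin d → ℝ) → ℝ} (hV : IsSubsolution θ R V)
    (hfirst : ∀ w, 0 ≤ w → w ≠ 0 → ∃ q, IsAdmissible θ R 0 w q ∧ V w < q ⬝ᵥ w)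
    {v : Fin d → ℝ} (hv : v ≠ 0) {T : ℝ} (h : IsFeasible R v T x y z) {n : ℕ}
    (hn : HasSegments z T n) : V v < cost θ 1 x T := by
  obtain ⟨τ, hτ⟩ := hn
  have hz0 := h.isRegulation.initial h.memH
  cases n with
  | zero =>
    have hT : T = 0 := by rw [← hτ.last, ← hτ.first]; rfl
    exact absurd (by rw [← h.terminal, hT, hz0]) hv
  | succ n =>
    have hlt : τ (Fin.castSucc 0) < τ (Fin.succ 0) := hτ.strictMono Fin.castSucc_lt_succ
    have h0 : τ (Fin.castSucc 0) = 0 := hτ.first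
    obtain ⟨u, hu, hlin⟩ := hτ.linear 0
    have hw : z (τ (Fin.succ 0)) ≠ 0 := by
      rw [hlin _ (right_mem_Icc.2 hlt.le), h0, hz0, zero_add, sub_zero]
      exact smul_ne_zero (by rw [h0] at hlt; exact hlt.ne') hu
    obtain ⟨q, hq, hVq⟩ := hfirst _ (h.isRegulation.nonneg _ (hτ.nonneg _)) hw
    have h1 := dotProduct_sub_le_of_linear (θ := θ) (q := q) h.isRegulation h.memH
      (hτ.nonneg _) hlt (by rwa [h0, hz0]) hlin
    have h2 := hV.le_integral h.isRegulation h.memH hτ (Fin.succ 0) (Fin.last (n + 1))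
      (Fin.le_last _)
    rw [h0, hz0, sub_zero] at h1
    rw [hτ.last, h.terminal] at h2
    have h3 := intervalIntegral.integral_add_adjacent_intervals
      (h.memH.intervalIntegrable θ le_rfl (hτ.nonneg (Fin.succ 0)))
      (h.memH.intervalIntegrable θ (hτ.nonneg (Fin.succ 0))
        ((hτ.strictMono.monotone (Fin.le_last _)).trans_eq hτ.last))
    rw [cost, ← h3]
    linarith

end LowerBound

/-! ### Appending a segment of constant velocity to a path. -/

section Extension

/-- The elapsed part, at time `t`, of a time interval of length `δ` that begins at time `T`. -/
noncomputable def elapsed (T δ t : ℝ) : ℝ := max 0 (min (t - T) δ)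

theorem elapsed_nonneg (T δ t : ℝ) : 0 ≤ elapsed T δ t := le_max_left _ _

theorem elapsed_le {δ : ℝ} (hδ : 0 ≤ δ) (T t : ℝ) : elapsed T δ t ≤ δ :=
  max_le hδ (min_le_right _ _)

theorem elapsed_of_le {T δ t : ℝ} (h : t ≤ T) : elapsed T δ t = 0 :=
  max_eq_left ((min_le_left _ _).trans (by linarith))

theorem elapsed_of_mem {T δ t : ℝ} (h : t ∈ Icc T (T + δ)) : elapsed T δ t = t - T := by
  rw [elapsed, min_eq_left (by linarith [h.2]), max_eq_right (by linarith [h.1])]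

theorem elapsed_mono (T δ : ℝ) : Monotone (elapsed T δ) := fun s t h =>
  max_le_max le_rfl (min_le_min (by linarith) le_rfl)

theorem lipschitzWith_elapsed (T δ : ℝ) : LipschitzWith 1 (elapsed T δ) :=
  ((IsometryEquiv.subRight T).isometry.lipschitz.min_const δ).const_max 0

theorem continuous_elapsed (T δ : ℝ) : Continuous (elapsed T δ) :=
  (lipschitzWith_elapsed T δ).continuous

variable {d : ℕ} {R : Matrix (Fin d) (Fin d) ℝ} {θ : Fin d → ℝ}

/-- The path that follows `x` up to time `T` and then moves with velocity `u` for a time `δ`. -/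
noncomputable def extend (x : ℝ → Fin d → ℝ) (T δ : ℝ) (u : Fin d → ℝ) (t : ℝ) : Fin d → ℝ :=
  x (min t T) + elapsed T δ t • u

theorem extend_of_le {x : ℝ → Fin d → ℝ} {T δ t : ℝ} {u : Fin d → ℝ} (h : t ≤ T) :
    extend x T δ u t = x t := by
  simp [extend, min_eq_left h, elapsed_of_le h]

theorem extend_of_mem {x : ℝ → Fin d → ℝ} {T δ t : ℝ} {u : Fin d → ℝ} (h : t ∈ Icc T (T + δ)) :
    extend x T δ u t = x T + (t - T) • u := by
  simp [extend, min_eq_right h.1, elapsed_of_mem h]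

theorem extend_of_ge {x : ℝ → Fin d → ℝ} {T δ t : ℝ} {u : Fin d → ℝ} (h : T ≤ t) :
    extend x T δ u t = x T + elapsed T δ t • u := by
  simp [extend, min_eq_right h]

theorem continuousOn_extend {x : ℝ → Fin d → ℝ} {T : ℝ} (hT : 0 ≤ T)
    (hx : ContinuousOn x (Ici 0)) (δ : ℝ) (u : Fin d → ℝ) :
    ContinuousOn (extend x T δ u) (Ici 0) := by
  refine ContinuousOn.add (hx.comp (by fun_prop) fun t ht => le_min ht hT) ?_
  exact ((continuous_elapsed T δ).smul continuous_const).continuousOn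

theorem exists_lipschitzWith_extend {x : ℝ → Fin d → ℝ} (hx : ∃ C, LipschitzWith C x)
    (T δ : ℝ) (u : Fin d → ℝ) : ∃ C, LipschitzWith C (extend x T δ u) := by
  obtain ⟨C, hC⟩ := hx
  have h1 : LipschitzWith (C * 1) (fun t => x (min t T)) := hC.comp (LipschitzWith.id.min_const T)
  have h2 := (ContinuousLinearMap.toSpanSingleton ℝ u).lipschitz.comp (lipschitzWith_elapsed T δ)
  exact ⟨_, h1.add h2⟩

theorem MemH.of_lipschitzWith {x : ℝ → Fin d → ℝ} (hx : ∃ C, LipschitzWith C x) (h0 : x 0 = 0) :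
    MemH x := by
  obtain ⟨C, hC⟩ := hx
  refine ⟨fun T _ => hC.lipschitzOnWith.absolutelyContinuousOnInterval, fun T _ => ?_, h0⟩
  exact MemLp.of_bound (measurable_deriv x).aestronglyMeasurable C
    (Filter.Eventually.of_forall fun t => norm_deriv_le_of_lipschitz hC)

theorem IsRegulation.eq_of_pos {x y z : ℝ → Fin d → ℝ} (h : IsRegulation R x y z) (i : Fin d)
    {s t : ℝ} (hs : 0 ≤ s) (hst : s ≤ t) (hpos : ∀ u ∈ Icc s t, 0 < z u i) : y t i = y s i :=
  eq_of_lintegral_eq_zero (h.monotone i) (continuousOn_pi.1 h.continuousOn_y i)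
    (continuousOn_pi.1 h.continuousOn_z i) (h.integral_eq_zero i) hs hst hpos

variable {x y z : ℝ → Fin d → ℝ} {v u η : Fin d → ℝ} {T δ : ℝ}

/-- Pushing is allowed only in coordinates that are zero at `v` and stay zero, which preserves
complementarity; after `T + δ` everything is frozen. The Lipschitz hypothesis gives membership in
`MemH`. -/
theorem IsFeasible.extend (h : IsFeasible R v T x y z) (hx : ∃ C, LipschitzWith C x) (hδ : 0 ≤ δ)
    (hη : 0 ≤ η) (hc : ∀ i, η i ≠ 0 → v i = 0 ∧ (u + R.mulVec η) i = 0)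
    (hend : 0 ≤ v + δ • (u + R.mulVec η)) :
    IsFeasible R (v + δ • (u + R.mulVec η)) (T + δ) (extend x T δ u) (extend y T δ η)
      (extend z T δ (u + R.mulVec η)) := by
  have hT := h.time_nonneg
  have hreg := h.isRegulation
  have hv : 0 ≤ v := h.terminal ▸ hreg.nonneg T hT
  set w := u + R.mulVec η with hw
  have hmono : ∀ i, MonotoneOn (fun t => SRBM.extend y T δ η t i) (Ici 0) := fun i s hs t ht hst =>
    add_le_add (hreg.monotone i (le_min hs hT) (le_min ht hT) (min_le_min hst le_rfl))
      (mul_le_mul_of_nonneg_right (elapsed_mono T δ hst) (hη i))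
  have hcy := continuousOn_extend hT hreg.continuousOn_y δ η
  have hcz := continuousOn_extend hT hreg.continuousOn_z δ w
  refine ⟨by linarith, MemH.of_lipschitzWith (exists_lipschitzWith_extend hx T δ u)
    (by rw [extend_of_le hT]; exact h.memH.zero),
    ⟨continuousOn_extend hT hreg.continuousOn_x δ u, hcy, hcz, ?_, ?_, hmono, ?_, ?_⟩, ?_⟩
  · intro t ht
    simp only [SRBM.extend]
    rw [hreg.eq_add _ (le_min ht hT), Matrix.mulVec_add, Matrix.mulVec_smul, hw, smul_add]
    abel
  · intro t ht
    rcases le_total t T with htT | htT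
    · rw [extend_of_le htT]; exact hreg.nonneg t ht
    · rw [extend_of_ge htT, h.terminal]
      intro i
      have h1 : 0 ≤ v i := hv i
      have h2 : 0 ≤ v i + δ * w i := hend i
      have h3 := elapsed_nonneg T δ t
      have h4 := elapsed_le hδ T t
      change 0 ≤ v i + elapsed T δ t * w i
      rcases le_total 0 (w i) with h5 | h5
      · positivity
      · nlinarith
  · rw [extend_of_le hT]; exact hreg.zero
  · intro i
    refine lintegral_eq_zero_of_eq (hmono i) (continuousOn_pi.1 hcy i) (continuousOn_pi.1 hcz i) ?_
    intro s t hs hst hpos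
    have hold : y (min t T) i = y (min s T) i := by
      rcases le_total s T with hsT | hsT
      · refine hreg.eq_of_pos i (le_min hs hT) (min_le_min hst le_rfl) fun r hr => ?_
        rw [min_eq_left hsT] at hr
        have := hpos r ⟨hr.1, hr.2.trans (min_le_left _ _)⟩
        rwa [extend_of_le (hr.2.trans (min_le_right _ _))] at this
      · rw [min_eq_right hsT, min_eq_right (hsT.trans hst)]
    have hnew : elapsed T δ t * η i = elapsed T δ s * η i := by
      by_cases hi : η i = 0
      · rw [hi, mul_zero, mul_zero]
      · have htT : t ≤ T := by
          by_contra! hTt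
          have := hpos t ⟨hst, le_rfl⟩
          rw [extend_of_ge hTt.le, h.terminal] at this
          simp [(hc i hi).1, (hc i hi).2] at this
        rw [elapsed_of_le htT, elapsed_of_le (hst.trans htT)]
    change y (min t T) i + elapsed T δ t * η i = y (min s T) i + elapsed T δ s * η i
    rw [hold, hnew]
  · rw [extend_of_mem ⟨by linarith, le_rfl⟩, h.terminal, add_sub_cancel_left]

theorem cost_extend (hT : 0 ≤ T) (hx' : MemH (SRBM.extend x T δ u)) (hδ : 0 ≤ δ) :
    cost θ 1 (SRBM.extend x T δ u) (T + δ) = cost θ 1 x T + δ * (1 / 2 * normSq 1 (u - θ)) := by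
  have hTδ : T ≤ T + δ := by linarith
  have h1 : ∫ t in (0 : ℝ)..T, normSq 1 (deriv (SRBM.extend x T δ u) t - θ) =
      ∫ t in (0 : ℝ)..T, normSq 1 (deriv x t - θ) := by
    refine intervalIntegral.integral_congr_Ioo_of_le hT fun t ht => ?_
    have : SRBM.extend x T δ u =ᶠ[nhds t] x := by
      filter_upwards [gt_mem_nhds ht.2] with s hs using extend_of_le hs.le
    simp only [this.deriv_eq]
  have h2 : ∫ t in T..(T + δ), normSq 1 (deriv (SRBM.extend x T δ u) t - θ) =
      ∫ t in T..(T + δ), normSq 1 (u - θ) := by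
    refine intervalIntegral.integral_congr_Ioo_of_le hTδ fun t ht => ?_
    have he : SRBM.extend x T δ u =ᶠ[nhds t] fun s => x T + (s - T) • u := by
      filter_upwards [Ioo_mem_nhds ht.1 ht.2] with s hs
        using extend_of_mem (Ioo_subset_Icc_self hs)
    have hd : HasDerivAt (fun s => x T + (s - T) • u) ((1 : ℝ) • u) t :=
      (((hasDerivAt_id t).sub_const T).smul_const u).const_add (x T)
    simp only [he.deriv_eq, hd.deriv, one_smul]
  rw [cost, ← intervalIntegral.integral_add_adjacent_intervals
    (hx'.intervalIntegrable θ le_rfl hT) (hx'.intervalIntegrable θ hT hTδ), h1, h2,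
    intervalIntegral.integral_const, cost, add_sub_cancel_left, smul_eq_mul]
  ring

theorem isFeasible_zero : IsFeasible R 0 0 (fun _ => 0) (fun _ => 0) (fun _ => 0) := by
  refine ⟨le_rfl, MemH.of_lipschitzWith ⟨0, LipschitzWith.const 0⟩ rfl,
    ⟨continuousOn_const, continuousOn_const, continuousOn_const, by simp, by simp,
      fun i => monotoneOn_const, rfl, fun i => by simp⟩, rfl⟩

end Extension

/-! ### Polynomial inequalities that separate direct from spiralling motion. -/

section Algebra

/-- The distinguished vertex of the polar set of an axis, with the signs that decide between direct
and spiralling paths. -/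
theorem exists_axis_dual {r b : ℝ} (hb : 0 ≤ b) (hbr : b < r) (hs : r + b < 2) :
    ∃ p₁ p₂ p₃ : ℝ, p₁ * p₁ + p₂ * p₂ + p₃ * p₃ = 2 * (p₁ + p₂ + p₃) ∧
      p₂ + r * p₃ + b * p₁ = 0 ∧ p₃ + r * p₁ + b * p₂ = 0 ∧ 0 < p₁ ∧ p₃ < 0 ∧
      0 < p₁ + p₂ + p₃ ∧
      (r ≤ 1 → p₂ ≤ p₁ ∧ 0 < (1 - p₂) - b * (1 - p₃) ∧ 0 < (1 - p₃) - r * (1 - p₂) ∧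
        (1 + b ^ 2) * (p₁ - p₂) < 2 * ((1 - p₂) - b * (1 - p₃)) ∧
        (1 + r ^ 2) * (p₁ - p₃) ≤ 2 * ((1 - p₃) - r * (1 - p₂))) ∧
      (1 < r → 2 * (2 - (r + b)) < p₁ * (2 + (r + b) ^ 2)) := by
  have hb1 : b < 1 := by linarith
  have hr : 0 < r := by linarith
  set D := 1 + r ^ 2 + b ^ 2 + r + b + r * b with hD
  have hD0 : 0 < D := by positivity
  have hrb : 0 < 1 - r * b := by nlinarith [sq_nonneg (r - b)]
  have hP3 : b ^ 2 - r < 0 := by nlinarith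
  have hS : 0 < 1 + r ^ 2 + b ^ 2 - r - b - r * b := by
    nlinarith [sq_nonneg (1 - r), sq_nonneg (1 - b), sq_pos_of_pos (sub_pos.2 hbr)]
  -- `P = (1 - rb, r² - b, b² - r)` is the cross product of the two reflection vectors. As `|P|² = D
  -- · ∑ P`, the factor `2 / D` places it on the sphere.
  obtain ⟨t, ht⟩ : ∃ t, t = 2 / D := ⟨_, rfl⟩
  have htD : t * D = 2 := by rw [ht]; field_simp
  have ht0 : 0 < t := by rw [ht]; positivity
  -- The left side is `(α - p₁)(2 + (r + b)²)`; the factor `1 - r` on the right decides its sign.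
  have hα : 2 * (2 - (r + b)) - t * (1 - r * b) * (2 + (r + b) ^ 2) =
      t * ((r + b) * (1 + r + b) * ((1 - r) * (1 - b))) := by
    have : 2 * (2 - (r + b)) = t * D * (2 - (r + b)) := by rw [htD]
    rw [this, hD]; ring
  have hsph : (t * (1 - r * b)) * (t * (1 - r * b)) + (t * (r ^ 2 - b)) * (t * (r ^ 2 - b)) +
      (t * (b ^ 2 - r)) * (t * (b ^ 2 - r)) =
      2 * (t * (1 - r * b) + t * (r ^ 2 - b) + t * (b ^ 2 - r)) := by
    linear_combination (norm := skip) (t * (1 + r ^ 2 + b ^ 2 - r - b - r * b)) * htD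
    rw [hD]; ring
  refine ⟨t * (1 - r * b), t * (r ^ 2 - b), t * (b ^ 2 - r), hsph, by ring, by ring,
    by positivity, mul_neg_of_pos_of_neg ht0 hP3, ?_, fun hr1 => ?_, fun hr1 => ?_⟩
  · have := mul_pos ht0 hS
    linarith
  · have h21 : t * (r ^ 2 - b) ≤ t * (1 - r * b) :=
      mul_le_mul_of_nonneg_left (by nlinarith) ht0.le
    have he2 : 0 < (1 - t * (r ^ 2 - b)) - b * (1 - t * (b ^ 2 - r)) := by
      have e : 2 * ((1 - t * (r ^ 2 - b)) - b * (1 - t * (b ^ 2 - r))) =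
          t * (1 - r ^ 2 + r - r ^ 2 * b + b ^ 3 - r * b ^ 2 + 2 * b - 2 * r * b) := by
        linear_combination (norm := skip) (-(1 - b)) * htD
        rw [hD]; ring
      have : 0 < 1 - r ^ 2 + r - r ^ 2 * b + b ^ 3 - r * b ^ 2 + 2 * b - 2 * r * b := by
        have h1 : 0 < r * ((1 - b) ^ 2 * (1 + b)) :=
          mul_pos hr (mul_pos (pow_pos (by linarith) 2) (by linarith))
        have h2 : 0 ≤ (1 - r) * (1 + 2 * b + b ^ 3) :=
          mul_nonneg (by linarith) (by positivity)
        have h3 : 0 ≤ (1 + b) * (r * (1 - r)) :=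
          mul_nonneg (by linarith) (mul_nonneg hr.le (by linarith))
        linarith
      have := mul_pos ht0 this
      linarith
    have he3 : 0 < (1 - t * (b ^ 2 - r)) - r * (1 - t * (r ^ 2 - b)) := by
      have e : 2 * ((1 - t * (b ^ 2 - r)) - r * (1 - t * (r ^ 2 - b))) =
          t * (1 - b ^ 2 + b - b ^ 2 * r + r ^ 3 - b * r ^ 2 + 2 * r - 2 * r * b) := by
        linear_combination (norm := skip) (-(1 - r)) * htD
        rw [hD]; ring
      have : 0 < 1 - b ^ 2 + b - b ^ 2 * r + r ^ 3 - b * r ^ 2 + 2 * r - 2 * r * b := by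
        have h1 : 0 ≤ r ^ 2 * (r - b) := mul_nonneg (sq_nonneg r) (by linarith)
        have h2 : 0 ≤ (1 - r) * (1 - b ^ 2 + b) :=
          mul_nonneg (by linarith) (by linarith [mul_nonneg hb (sub_nonneg.2 hb1.le)])
        have h3 : 0 < r * ((1 - b) * (3 + 2 * b)) :=
          mul_pos hr (mul_pos (by linarith) (by linarith))
        linarith
      have := mul_pos ht0 this
      linarith
    have hQ : 0 ≤ t * ((r + b) * (1 + r + b) * ((1 - r) * (1 - b))) := by
      have : 0 ≤ 1 - r := by linarith
      have : 0 ≤ 1 - b := by linarith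
      positivity
    refine ⟨h21, he2, he3, ?_, ?_⟩
    -- Modulo the sphere equation, `p₁ - p₂` times the desired gap is `p₁` times the left side of
    -- `hα`. At `r = 1` the factor `p₁ - p₂` vanishes, and `he2` gives the claim.
    · rcases hr1.lt_or_eq with hlt | rfl
      · have hpos : 0 < t * (1 - r * b) - t * (r ^ 2 - b) := by
          have : 0 < t * ((1 - r) * (1 + r + b)) :=
            mul_pos ht0 (mul_pos (by linarith) (by linarith))
          linarith
        have hQ' : 0 < t * ((r + b) * (1 + r + b) * ((1 - r) * (1 - b))) := by
          have : 0 < 1 - r := by linarith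
          have : 0 < 1 - b := by linarith
          positivity
        have hp1 : 0 < t * (1 - r * b) := by positivity
        refine lt_of_mul_lt_mul_left ?_ hpos.le
        have := mul_pos hp1 hQ'
        rw [← hα] at this
        linear_combination this - hsph
      · have : t * (1 - 1 * b) - t * (1 ^ 2 - b) = 0 := by ring
        rw [this, mul_zero]
        linarith
    · have hpos : 0 < t * (1 - r * b) - t * (b ^ 2 - r) := by
        have := mul_pos ht0 hrb
        have := mul_neg_of_pos_of_neg ht0 hP3
        linarith
      have hp1 : 0 < t * (1 - r * b) := by positivity
      refine le_of_mul_le_mul_left ?_ hpos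
      have := mul_nonneg hp1.le hQ
      rw [← hα] at this
      linear_combination this - hsph
  · have : t * ((r + b) * (1 + r + b) * ((1 - r) * (1 - b))) < 0 := by
      refine mul_neg_of_pos_of_neg ht0 (mul_neg_of_pos_of_neg (by positivity) ?_)
      exact mul_neg_of_neg_of_pos (by linarith) (by linarith)
    linarith

/-- For `r > 1` the diagonal point of the sphere is not a maximizer of any nonnegative direction. -/
theorem spiral_normal_neg {r b : ℝ} (hb : 0 ≤ b) (hr : 1 < r) (hs : r + b < 2) {α : ℝ}
    (hα : α * (2 + (r + b) ^ 2) = 2 * (2 - (r + b))) :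
    α - 1 + b * (1 + (r + b) * α) < 0 := by
  have hb1 : b < 1 := by linarith
  have hpos : 0 < 2 + (r + b) ^ 2 := by positivity
  refine neg_of_mul_neg_right (a := 2 + (r + b) ^ 2) ?_ hpos.le
  have key : (2 + (r + b) ^ 2) * (α - 1 + b * (1 + (r + b) * α)) =
      2 * (2 - (r + b)) * (1 + b * (r + b)) - (1 - b) * (2 + (r + b) ^ 2) := by
    linear_combination (1 + b * (r + b)) * hα
  rw [key]
  -- At `δ = 0` the expression is `-(1 - b)(1 - b²) < 0`; the products below control the terms in
  -- `δ`.
  set δ := r - 1 with hδ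
  have hδ0 : 0 < δ := by linarith
  have hr' : r = 1 + δ := by rw [hδ]; ring
  rw [hr']
  have h1 := mul_nonneg hb hδ0.le
  have h2 := mul_nonneg h1 hb
  have h3 := mul_nonneg h1 hδ0.le
  have h4 : 0 < (1 - b) * (1 - b ^ 2) := mul_pos (by linarith) (by nlinarith)
  have h5 : 0 ≤ (1 - b) * (δ * (2 * (1 + b) + δ)) :=
    mul_nonneg (by linarith) (by positivity)
  have h6 := mul_nonneg h1 (by linarith : (0:ℝ) ≤ 1 - b)
  nlinarith

/-- Two points of the sphere and of the polar line of a face are separated by the normal. -/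
theorem sphere_separation {r b h₁ h₂ h₃ g₁ g₂ g₃ : ℝ}
    (hh : h₁ * h₁ + h₂ * h₂ + h₃ * h₃ = 2 * (h₁ + h₂ + h₃))
    (hg : g₁ * g₁ + g₂ * g₂ + g₃ * g₃ = 2 * (g₁ + g₂ + g₃))
    (hh' : h₃ + r * h₁ + b * h₂ = 0) (hg' : g₃ + r * g₁ + b * g₂ = 0) :
    2 * ((h₁ - g₁) * (h₁ - 1 + r * (1 - h₃)) + (h₂ - g₂) * (h₂ - 1 + b * (1 - h₃))) =
      (h₁ - g₁) ^ 2 + (h₂ - g₂) ^ 2 + (h₃ - g₃) ^ 2 := by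
  linear_combination hh - hg + 2 * (1 - h₃) * (hh' - hg')

end Algebra

/-! ### Coordinates in cyclic order, which exploit the rotational symmetry. -/

section Cyclic

theorem fin_three_add (c : Fin 3) :
    c + 1 + 1 = c + 2 ∧ c + 1 + 2 = c ∧ c + 2 + 1 = c ∧ c + 2 + 2 = c + 1 := by
  revert c; decide

theorem sum_cyclic (c : Fin 3) (f : Fin 3 → ℝ) : ∑ i, f i = f c + f (c + 1) + f (c + 2) := by
  fin_cases c <;> simp [Fin.sum_univ_three] <;> ring

theorem dotProduct_cyclic (c : Fin 3) (f g : Fin 3 → ℝ) :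
    f ⬝ᵥ g = f c * g c + f (c + 1) * g (c + 1) + f (c + 2) * g (c + 2) :=
  sum_cyclic c fun i => f i * g i

theorem forall_cyclic (c : Fin 3) {P : Fin 3 → Prop} :
    (∀ i, P i) ↔ P c ∧ P (c + 1) ∧ P (c + 2) := by
  refine ⟨fun h => ⟨h _, h _, h _⟩, fun ⟨h0, h1, h2⟩ i => ?_⟩
  have : ∀ c i : Fin 3, i = c ∨ i = c + 1 ∨ i = c + 2 := by decide
  rcases this c i with rfl | rfl | rfl <;> assumption

/-- The vector with the coordinates `A`, `B`, `C` in the cyclic order that begins at `c`. -/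
def cyc (c : Fin 3) (A B C : ℝ) : Fin 3 → ℝ := fun i =>
  if i = c then A else if i = c + 1 then B else C

@[simp] theorem cyc_zero (c : Fin 3) (A B C : ℝ) : cyc c A B C c = A := by simp [cyc]

@[simp] theorem cyc_one (c : Fin 3) (A B C : ℝ) : cyc c A B C (c + 1) = B := by
  simp [cyc]

@[simp] theorem cyc_two (c : Fin 3) (A B C : ℝ) : cyc c A B C (c + 2) = C := by
  simp [cyc]

theorem eq_cyc (c : Fin 3) (v : Fin 3 → ℝ) : v = cyc c (v c) (v (c + 1)) (v (c + 2)) :=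
  funext ((forall_cyclic c).2 ⟨by simp, by simp, by simp⟩)

theorem cyc_rotate (c : Fin 3) (A B C : ℝ) : cyc (c + 1) A B C = cyc c C A B := by
  obtain ⟨h1, h2, h3, h4⟩ := fin_three_add c
  refine funext ((forall_cyclic (c + 1)).2 ⟨by simp, ?_, ?_⟩)
  · rw [cyc_one, h1, cyc_two]
  · rw [cyc_two, h2, cyc_zero]

theorem cyc_rotate_two (c : Fin 3) (A B C : ℝ) : cyc (c + 2) A B C = cyc c B C A := by
  rw [← (fin_three_add c).1, cyc_rotate, cyc_rotate]

theorem cyc_add (c : Fin 3) (A B C A' B' C' : ℝ) :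
    cyc c A B C + cyc c A' B' C' = cyc c (A + A') (B + B') (C + C') := by
  rw [eq_cyc c (_ + _)]; simp

theorem smul_cyc (c : Fin 3) (t A B C : ℝ) : t • cyc c A B C = cyc c (t * A) (t * B) (t * C) := by
  rw [eq_cyc c (_ • _)]; simp

theorem cyc_dotProduct (c : Fin 3) (A B C : ℝ) (v : Fin 3 → ℝ) :
    cyc c A B C ⬝ᵥ v = A * v c + B * v (c + 1) + C * v (c + 2) := by
  rw [dotProduct_cyclic c]; simp

theorem cyc_nonneg {c : Fin 3} {A B C : ℝ} (hA : 0 ≤ A) (hB : 0 ≤ B) (hC : 0 ≤ C) :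
    0 ≤ cyc c A B C :=
  (forall_cyclic c).2 ⟨by simpa, by simpa, by simpa⟩

/-- The rotationally symmetric reflection matrix. -/
def circ (r b : ℝ) : Matrix (Fin 3) (Fin 3) ℝ := !![1, b, r; r, 1, b; b, r, 1]

theorem circ_mulVec (r b : ℝ) (y : Fin 3 → ℝ) (c : Fin 3) :
    (circ r b).mulVec y c = y c + b * y (c + 1) + r * y (c + 2) := by
  fin_cases c <;> simp [circ, Matrix.mulVec, dotProduct, Fin.sum_univ_three] <;> ring

theorem dotProduct_circ_col (r b : ℝ) (q : Fin 3 → ℝ) (c : Fin 3) :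
    q ⬝ᵥ (circ r b).col c = q c + r * q (c + 1) + b * q (c + 2) := by
  fin_cases c <;> simp [circ, Matrix.col, dotProduct, Fin.sum_univ_three] <;> ring

theorem circ_mulVec_cyc (r b : ℝ) (c : Fin 3) (A B C : ℝ) :
    (circ r b).mulVec (cyc c A B C) =
      cyc c (A + b * B + r * C) (B + b * C + r * A) (C + b * A + r * B) := by
  obtain ⟨h1, h2, h3, h4⟩ := fin_three_add c
  refine funext ((forall_cyclic c).2 ⟨?_, ?_, ?_⟩) <;> rw [circ_mulVec] <;> simp [h1, h2, h3, h4]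

end Cyclic

/-! ### Upper bounds for the value from explicit paths, and criteria for gradual paths. -/

section Construction

variable {d : ℕ}

/-- Some Lipschitz path `x` with regulation `z` reaches `v` at time `T` at cost `C`. -/
def IsReached (θ : Fin d → ℝ) (R : Matrix (Fin d) (Fin d) ℝ) (v : Fin d → ℝ) (T : ℝ)
    (z : ℝ → Fin d → ℝ) (C : ℝ) : Prop :=
  ∃ x y, IsFeasible R v T x y z ∧ (∃ L, LipschitzWith L x) ∧ cost θ 1 x T = C

variable {θ : Fin d → ℝ} {R : Matrix (Fin d) (Fin d) ℝ} {v u η : Fin d → ℝ} {T δ C : ℝ}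
  {z : ℝ → Fin d → ℝ}

theorem isReached_zero : IsReached θ R 0 0 (fun _ => 0) 0 :=
  ⟨_, _, isFeasible_zero, ⟨0, LipschitzWith.const 0⟩, by simp [cost]⟩

theorem IsReached.extend (h : IsReached θ R v T z C) (hδ : 0 ≤ δ)
    (hη : 0 ≤ η) (hc : ∀ i, η i ≠ 0 → v i = 0 ∧ (u + R.mulVec η) i = 0)
    (hend : 0 ≤ v + δ • (u + R.mulVec η)) :
    IsReached θ R (v + δ • (u + R.mulVec η)) (T + δ) (extend z T δ (u + R.mulVec η))
      (C + δ * (1 / 2 * normSq 1 (u - θ))) := by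
  obtain ⟨x, y, hf, hx, rfl⟩ := h
  have hf' := hf.extend hx hδ hη hc hend
  exact ⟨_, _, hf', exists_lipschitzWith_extend hx T δ u,
    cost_extend hf.time_nonneg hf'.memH hδ⟩

theorem cost_nonneg (θ : Fin d → ℝ) (x : ℝ → Fin d → ℝ) {T : ℝ} (hT : 0 ≤ T) :
    0 ≤ cost θ 1 x T := by
  have : 0 ≤ ∫ t in (0 : ℝ)..T, normSq 1 (deriv x t - θ) :=
    intervalIntegral.integral_nonneg hT fun t _ => by
      rw [normSq_one]; simpa using dotProduct_star_self_nonneg (deriv x t - θ)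
  rw [cost]; positivity

theorem value_le {x y : ℝ → Fin d → ℝ} (h : IsFeasible R v T x y z) :
    value θ 1 R v ≤ cost θ 1 x T := by
  refine csInf_le ⟨0, ?_⟩ ⟨T, x, y, z, h, rfl⟩
  rintro c ⟨T', x', y', z', h', rfl⟩
  exact cost_nonneg θ x' h'.time_nonneg

theorem IsReached.value_le (h : IsReached θ R v T z C) : value θ 1 R v ≤ C := by
  obtain ⟨x, y, hf, -, rfl⟩ := h
  exact SRBM.value_le hf

theorem IsReached.isOptimalPath (h : IsReached θ R v T z C) (hC : C ≤ value θ 1 R v) :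
    IsOptimalPath θ 1 R v T z := by
  obtain ⟨x, y, hf, -, rfl⟩ := h
  exact ⟨x, y, hf, le_antisymm hC (SRBM.value_le hf)⟩

theorem IsSubsolution.le_value {V : (Fin d → ℝ) → ℝ} (hV : IsSubsolution θ R V) (hV0 : V 0 = 0)
    {n : ℕ} (h : IsOptimalPath θ 1 R v T z) (hn : HasSegments z T n) : V v ≤ value θ 1 R v := by
  obtain ⟨x, y, hf, hc⟩ := h
  exact hc ▸ hV.le_cost hV0 hf hn

theorem IsGradual.hasSegments {n : ℕ} (h : IsGradual z T n) : HasSegments z T n := by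
  obtain ⟨τ, K, hτ, -⟩ := h
  exact ⟨τ, hτ⟩

theorem isGradual_one (hT : 0 < T) (hz : ∀ t ∈ Icc 0 T, z t = t • u) (hu : u ≠ 0)
    (K : Finset (Fin d)) (hK : ∀ i ∈ K, u i = 0) (hK' : ∀ i ∉ K, 0 < u i) :
    IsGradual z T 1 := by
  have hz0 : z 0 = 0 := by rw [hz 0 ⟨le_rfl, hT.le⟩, zero_smul]
  refine ⟨![0, T], fun _ => K, ⟨rfl, rfl, ?_, ?_⟩, ?_, ?_⟩
  · rw [Fin.strictMono_iff_lt_succ]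
    intro i; fin_cases i; simpa using hT
  · intro k
    fin_cases k
    refine ⟨u, hu, fun t ht => ?_⟩
    change t ∈ Icc 0 T at ht
    change z t = z 0 + (t - 0) • u
    rw [hz t ht, hz0, zero_add, sub_zero]
  · intro k
    fin_cases k
    intro t ht
    change t ∈ Ioc 0 T at ht
    have hzt := hz t ⟨ht.1.le, ht.2⟩
    have hpos : ∀ i ∉ K, 0 < z t i := fun i hi => by
      rw [hzt]; exact mul_pos ht.1 (hK' i hi)
    have hzero : ∀ i ∈ K, z t i = 0 := fun i hi => by
      rw [hzt, Pi.smul_apply, hK i hi, smul_zero]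
    refine ⟨⟨fun i => ?_, hzero⟩, hpos⟩
    by_cases hi : i ∈ K
    · exact (hzero i hi).ge
    · exact (hpos i hi).le
  · intro i j hij
    exact absurd hij (by simp [Subsingleton.elim i j])

theorem isGradual_two {T₁ T₂ : ℝ} {u₁ u₂ : Fin d → ℝ} (hT₁ : 0 < T₁) (hT₂ : 0 < T₂)
    (hz₁ : ∀ t ∈ Icc 0 T₁, z t = t • u₁)
    (hz₂ : ∀ t ∈ Icc T₁ (T₁ + T₂), z t = T₁ • u₁ + (t - T₁) • u₂) (hu₁ : u₁ ≠ 0) (hu₂ : u₂ ≠ 0)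
    (K₁ K₂ : Finset (Fin d)) (hK₁ : ∀ i ∈ K₁, u₁ i = 0) (hK₁' : ∀ i ∉ K₁, 0 < u₁ i)
    (hK₂ : ∀ i ∈ K₂, u₁ i = 0 ∧ u₂ i = 0)
    (hK₂' : ∀ i ∉ K₂, 0 ≤ u₁ i ∧ 0 < (T₁ • u₁ + T₂ • u₂) i) (hcard : d - K₁.card < d - K₂.card) :
    IsGradual z (T₁ + T₂) 2 := by
  have hz0 : z 0 = 0 := by rw [hz₁ 0 ⟨le_rfl, hT₁.le⟩, zero_smul]
  have hzT : z T₁ = T₁ • u₁ := hz₁ T₁ ⟨hT₁.le, le_rfl⟩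
  refine ⟨![0, T₁, T₁ + T₂], ![K₁, K₂], ⟨rfl, rfl, ?_, ?_⟩, ?_, ?_⟩
  · rw [Fin.strictMono_iff_lt_succ]
    intro i
    fin_cases i
    · exact hT₁
    · change T₁ < T₁ + T₂; linarith
  · intro k
    fin_cases k
    · refine ⟨u₁, hu₁, fun t ht => ?_⟩
      change t ∈ Icc 0 T₁ at ht
      change z t = z 0 + (t - 0) • u₁
      rw [hz₁ t ht, hz0, zero_add, sub_zero]
    · refine ⟨u₂, hu₂, fun t ht => ?_⟩
      change t ∈ Icc T₁ (T₁ + T₂) at ht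
      change z t = z T₁ + (t - T₁) • u₂
      rw [hz₂ t ht, hzT]
  · intro k
    fin_cases k
    · intro t ht
      change t ∈ Ioc 0 T₁ at ht
      change z t ∈ face K₁ ∧ ∀ i ∉ K₁, 0 < z t i
      have hzt := hz₁ t ⟨ht.1.le, ht.2⟩
      have hpos : ∀ i ∉ K₁, 0 < z t i := fun i hi => by
        rw [hzt]; exact mul_pos ht.1 (hK₁' i hi)
      have hzero : ∀ i ∈ K₁, z t i = 0 := fun i hi => by
        rw [hzt, Pi.smul_apply, hK₁ i hi, smul_zero]
      refine ⟨⟨fun i => ?_, hzero⟩, hpos⟩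
      by_cases hi : i ∈ K₁
      · exact (hzero i hi).ge
      · exact (hpos i hi).le
    · intro t ht
      change t ∈ Ioc T₁ (T₁ + T₂) at ht
      change z t ∈ face K₂ ∧ ∀ i ∉ K₂, 0 < z t i
      have hzt := hz₂ t ⟨ht.1.le, ht.2⟩
      have hpos : ∀ i ∉ K₂, 0 < z t i := fun i hi => by
        obtain ⟨h1, h2⟩ := hK₂' i hi
        simp only [Pi.add_apply, Pi.smul_apply, smul_eq_mul] at h2
        -- A convex combination of a nonnegative start and a positive end.
        have h3 : T₂ * z t i = (T₁ + T₂ - t) * (T₁ * u₁ i) +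
            (t - T₁) * (T₁ * u₁ i + T₂ * u₂ i) := by
          rw [hzt]; simp only [Pi.add_apply, Pi.smul_apply, smul_eq_mul]; ring
        have h4 : 0 ≤ (T₁ + T₂ - t) * (T₁ * u₁ i) :=
          mul_nonneg (by linarith [ht.2]) (mul_nonneg hT₁.le h1)
        have h5 : 0 < (t - T₁) * (T₁ * u₁ i + T₂ * u₂ i) := mul_pos (by linarith [ht.1]) h2
        exact pos_of_mul_pos_right (by rw [h3]; linarith) hT₂.le
      have hzero : ∀ i ∈ K₂, z t i = 0 := fun i hi => by
        rw [hzt]; simp [(hK₂ i hi).1, (hK₂ i hi).2]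
      refine ⟨⟨fun i => ?_, hzero⟩, hpos⟩
      by_cases hi : i ∈ K₂
      · exact (hzero i hi).ge
      · exact (hpos i hi).le
  · rw [Fin.strictMono_iff_lt_succ]
    intro i
    fin_cases i
    exact hcard

end Construction

/-! ### Scaling by `κ`, and the moves that attain the dual bound. -/

section Duality

variable {d : ℕ} {R : Matrix (Fin d) (Fin d) ℝ} {κ : ℝ}

theorem dotProduct_const (q : Fin d → ℝ) (t : ℝ) : q ⬝ᵥ (fun _ => t) = t * ∑ i, q i := by
  rw [dotProduct, ← Finset.sum_mul, mul_comm]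

/-- Writing functionals as `κ • q` replaces the polar ball of the drift by one independent of `κ`.
-/
theorem isAdmissible_smul {a b q : Fin d → ℝ} (hκ : 0 ≤ κ) (hq : q ⬝ᵥ q ≤ 2 * ∑ i, q i)
    (hrefl : ∀ i, a i = 0 → b i = 0 → q ⬝ᵥ R.col i ≤ 0) :
    IsAdmissible (fun _ => -κ) R a b (κ • q) := by
  refine ⟨?_, fun i ha hb => ?_⟩
  · rw [dotProduct_const, smul_dotProduct, dotProduct_smul, smul_eq_mul, smul_eq_mul]
    simp only [Pi.smul_apply, smul_eq_mul, ← Finset.mul_sum]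
    nlinarith [mul_le_mul_of_nonneg_left hq (mul_nonneg hκ hκ)]
  · rw [smul_dotProduct]
    exact mul_nonpos_of_nonneg_of_nonpos hκ (hrefl i ha hb)

theorem isSubsolution_smul {V : (Fin d → ℝ) → ℝ} (hκ : 0 ≤ κ)
    (h : ∀ a b, 0 ≤ a → 0 ≤ b → ∃ q, q ⬝ᵥ q ≤ 2 * ∑ i, q i ∧
      (∀ i, a i = 0 → b i = 0 → q ⬝ᵥ R.col i ≤ 0) ∧ V b - V a ≤ q ⬝ᵥ b - q ⬝ᵥ a) :
    IsSubsolution (fun _ => -κ) R (fun z => κ * V z) := by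
  intro a b ha hb
  obtain ⟨q, h1, h2, h3⟩ := h a b ha hb
  refine ⟨κ • q, isAdmissible_smul hκ h1 h2, ?_⟩
  rw [smul_dotProduct, dotProduct_sub, ← mul_sub]
  exact mul_le_mul_of_nonneg_left h3 hκ

/-- Moving with the velocity that is conjugate to a point `q` of the polar sphere, the cost is the
increment of the linear functional `q`. -/
theorem IsReached.move (hκ : 0 < κ) {v q η : Fin d → ℝ} {T C l : ℝ} {z : ℝ → Fin d → ℝ}
    (h : IsReached (fun _ => -κ) R v T z C) (hq : q ⬝ᵥ q = 2 * ∑ i, q i) (hη : 0 ≤ η)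
    {w : Fin d → ℝ} (hw : w = q - (fun _ => 1) + R.mulVec η)
    (hc : ∀ i, η i ≠ 0 → v i = 0 ∧ w i = 0 ∧ q ⬝ᵥ R.col i = 0) (hl : 0 ≤ l)
    (hend : 0 ≤ v + l • w) :
    IsReached (fun _ => -κ) R (v + l • w) (T + l / κ) (SRBM.extend z T (l / κ) (κ • w))
      (C + κ * (q ⬝ᵥ (l • w))) := by
  have hwκ : κ • (q - fun _ => 1) + R.mulVec (κ • η) = κ • w := by
    rw [hw, Matrix.mulVec_smul, smul_add]
  have hlw : (l / κ) • κ • w = l • w := by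
    rw [smul_smul, div_mul_cancel₀ _ hκ.ne']
  have key := h.extend (u := κ • (q - fun _ => 1)) (η := κ • η) (δ := l / κ) (by positivity)
    (smul_nonneg hκ.le hη) (fun i hi => ?_) (by rwa [hwκ, hlw])
  · rw [hwκ, hlw] at key
    convert key using 2
    have h0 : q ⬝ᵥ R.mulVec η = 0 := by
      rw [Matrix.mulVec_eq_sum, dotProduct_sum]
      refine Finset.sum_eq_zero fun i _ => ?_
      rw [show (MulOpposite.op (η i) • R.transpose i) = η i • R.col i from by
        ext j; simp [mul_comm], dotProduct_smul, smul_eq_mul]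
      by_cases hi : η i = 0
      · rw [hi, zero_mul]
      · rw [(hc i hi).2.2, mul_zero]
    -- The running cost is `½κ²|q|² = κ² ∑ q`, and the velocity `κ • w` increases `κ q` at the same
    -- rate: the dual bound is attained.
    have h1 : q ⬝ᵥ w = ∑ i, q i := by
      rw [hw, dotProduct_add, dotProduct_sub, dotProduct_const, h0, hq]; ring
    have h2 : κ • (q - fun _ => 1) - (fun _ => -κ) = κ • q := by
      ext i; simp; ring
    rw [h2, normSq_one, smul_dotProduct, dotProduct_smul, dotProduct_smul, hq, h1]
    simp only [smul_eq_mul]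
    field_simp
  · rw [hwκ]
    have hi' : η i ≠ 0 := fun h => hi (by simp [h])
    exact ⟨(hc i hi').1, by simp [(hc i hi').2.1]⟩

end Duality

/-! ### Dual points of axes and faces. -/

section Duals

variable {r b p₁ p₂ p₃ q₁ q₂ q₃ : ℝ}

theorem cyc_dotProduct_self (c : Fin 3) (A B C : ℝ) :
    cyc c A B C ⬝ᵥ cyc c A B C = A * A + B * B + C * C := by
  rw [cyc_dotProduct]; simp

theorem sum_cyc (c : Fin 3) (A B C : ℝ) : ∑ i, cyc c A B C i = A + B + C := by
  rw [sum_cyclic c]; simp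

theorem cyc_dotProduct_col (c : Fin 3) (A B C : ℝ) :
    cyc c A B C ⬝ᵥ (circ r b).col c = A + r * B + b * C := by
  rw [dotProduct_circ_col]; simp

theorem cyc_dotProduct_col_one (c : Fin 3) (A B C : ℝ) :
    cyc c A B C ⬝ᵥ (circ r b).col (c + 1) = B + r * C + b * A := by
  rw [dotProduct_circ_col, (fin_three_add c).1, (fin_three_add c).2.1]; simp

theorem cyc_dotProduct_col_two (c : Fin 3) (A B C : ℝ) :
    cyc c A B C ⬝ᵥ (circ r b).col (c + 2) = C + r * A + b * B := by
  rw [dotProduct_circ_col, (fin_three_add c).2.2.1, (fin_three_add c).2.2.2]; simp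

/-- The dual vertex of an axis is tangent to the reflections along that axis. -/
theorem axis_dual_reflection (ht : p₂ + r * p₃ + b * p₁ = 0) (ht' : p₃ + r * p₁ + b * p₂ = 0)
    (k i : Fin 3) (hi : i ≠ k) : cyc k p₁ p₂ p₃ ⬝ᵥ (circ r b).col i = 0 := by
  revert hi
  refine (forall_cyclic k 
    (P := fun i => i ≠ k → cyc k p₁ p₂ p₃ ⬝ᵥ (circ r b).col i = 0)).2 ⟨fun h => absurd rfl h, fun _ => ?_,
    fun _ => ?_⟩ i
  · rw [cyc_dotProduct_col_one, ht]
  · rw [cyc_dotProduct_col_two, ht']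

theorem eq_zero_of_cyclic {c : Fin 3} {v : Fin 3 → ℝ} (h0 : v c = 0) (h1 : v (c + 1) = 0)
    (h2 : v (c + 2) = 0) : v = 0 :=
  funext ((forall_cyclic c).2 ⟨h0, h1, h2⟩)

theorem exists_pair {i c : Fin 3} (h : i ≠ c) :
    ∃ k : Fin 3, (i = k + 1 ∧ c = k + 2) ∨ (i = k + 2 ∧ c = k + 1) := by
  revert i c; decide

variable {κ : ℝ}

/-- Moving in the face `z c = 0` with the velocity that is conjugate to `(q₃, q₁, q₂)`. -/
theorem IsReached.faceMove (hκ : 0 < κ) {v : Fin 3 → ℝ} {T C l : ℝ} {z : ℝ → Fin 3 → ℝ}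
    (h : IsReached (fun _ => -κ) (circ r b) v T z C) {c : Fin 3} (hv : v c = 0)
    (hq : q₁ * q₁ + q₂ * q₂ + q₃ * q₃ = 2 * (q₁ + q₂ + q₃)) (hq' : q₃ + r * q₁ + b * q₂ = 0)
    (hq₃ : q₃ ≤ 1) (hl : 0 ≤ l) {n₁ n₂ : ℝ} (hn₁ : n₁ = q₁ - 1 + r * (1 - q₃))
    (hn₂ : n₂ = q₂ - 1 + b * (1 - q₃)) (hend : 0 ≤ v + l • cyc c 0 n₁ n₂) :
    IsReached (fun _ => -κ) (circ r b) (v + l • cyc c 0 n₁ n₂) (T + l / κ)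
      (SRBM.extend z T (l / κ) (κ • cyc c 0 n₁ n₂)) (C + κ * (l * (q₁ * n₁ + q₂ * n₂))) := by
  -- The push `1 - q₃` cancels coordinate `c` of `q - (1,1,1)`, so the motion stays in the face.
  have key := h.move hκ (q := cyc c q₃ q₁ q₂) (η := cyc c (1 - q₃) 0 0) (w := cyc c 0 n₁ n₂)
    (l := l) (by rw [cyc_dotProduct_self, sum_cyc]; linarith)
    (cyc_nonneg (by linarith) le_rfl le_rfl) ?_ ?_ hl hend
  · convert key using 2
    rw [dotProduct_smul, cyc_dotProduct]; simp
  · rw [circ_mulVec_cyc]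
    refine funext ((forall_cyclic c).2 ⟨?_, ?_, ?_⟩)
    · simp
    · simp [hn₁]
    · simp [hn₂]
  · refine (forall_cyclic c).2 ⟨fun _ => ⟨hv, by simp, ?_⟩, fun h => absurd (by simp) h,
      fun h => absurd (by simp) h⟩
    rw [cyc_dotProduct_col, hq']

end Duals

/-! ### The case `r > 1`: spirals beat every path with finitely many segments. -/

section Spiral

variable {r b α κ p₁ p₂ p₃ : ℝ}

/-- The smallest coordinate of a point. -/
noncomputable def minCoord (z : Fin 3 → ℝ) : ℝ :=
  Finset.univ.inf' Finset.univ_nonempty z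

theorem minCoord_le (z : Fin 3 → ℝ) (c : Fin 3) : minCoord z ≤ z c :=
  Finset.inf'_le _ (Finset.mem_univ c)

theorem exists_minCoord_eq (z : Fin 3 → ℝ) : ∃ c, minCoord z = z c := by
  obtain ⟨c, -, hc⟩ := Finset.exists_mem_eq_inf' Finset.univ_nonempty z
  exact ⟨c, hc⟩

theorem minCoord_eq_zero {z : Fin 3 → ℝ} (hz : 0 ≤ z) {c : Fin 3} (hc : z c = 0) :
    minCoord z = 0 := by
  obtain ⟨d, hd⟩ := exists_minCoord_eq z
  exact le_antisymm (hc ▸ minCoord_le z c) (hd ▸ hz d)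

/-- The limiting cost of spirals, extended to the octant. -/
noncomputable def spiralValue (α s : ℝ) (z : Fin 3 → ℝ) : ℝ :=
  α * ∑ i, z i - α * (1 + s) * minCoord z

theorem spiralValue_axis {s : ℝ} {z : Fin 3 → ℝ} (hz : 0 ≤ z) {k : Fin 3} (h1 : z (k + 1) = 0)
    (h2 : z (k + 2) = 0) : spiralValue α s z = α * z k := by
  rw [spiralValue, minCoord_eq_zero hz h1, sum_cyclic k, h1, h2]; ring

/-- With `spiralValue_eq`, this makes `spiralValue` the maximum of three linear functionals,
attained at a smallest coordinate. -/
theorem cyc_dotProduct_le_spiralValue {s : ℝ} (hα : 0 ≤ α) (hs : 0 ≤ s) (z : Fin 3 → ℝ)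
    (c : Fin 3) : cyc c (-(s * α)) α α ⬝ᵥ z ≤ spiralValue α s z := by
  rw [cyc_dotProduct, spiralValue, sum_cyclic c]
  have := mul_le_mul_of_nonneg_left (minCoord_le z c) (by positivity : 0 ≤ α * (1 + s))
  linarith

theorem spiralValue_eq {s : ℝ} {z : Fin 3 → ℝ} {c : Fin 3} (hc : minCoord z = z c) :
    spiralValue α s z = cyc c (-(s * α)) α α ⬝ᵥ z := by
  rw [cyc_dotProduct, spiralValue, sum_cyclic c, hc]; ring

/-- A move along an axis is bounded by a multiple of `p` with slope `α`. Otherwise at most one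
coordinate vanishes at both ends, and the diagonal functional of the face of a smallest coordinate
of `v` serves. -/
theorem exists_spiral_admissible (hr : 0 ≤ r) (hb : 0 ≤ b)
    (hα : α * (2 + (r + b) ^ 2) = 2 * (2 - (r + b))) (hα0 : 0 < α)
    (hp : p₁ * p₁ + p₂ * p₂ + p₃ * p₃ = 2 * (p₁ + p₂ + p₃)) (hsum : 0 < p₁ + p₂ + p₃)
    (ht : p₂ + r * p₃ + b * p₁ = 0) (ht' : p₃ + r * p₁ + b * p₂ = 0) (hαp : α < p₁)
    (a v : Fin 3 → ℝ) (ha : 0 ≤ a) (hv : 0 ≤ v) :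
    ∃ q, q ⬝ᵥ q ≤ 2 * ∑ i, q i ∧ (∀ i, a i = 0 → v i = 0 → q ⬝ᵥ (circ r b).col i ≤ 0) ∧
      spiralValue α (r + b) v - spiralValue α (r + b) a ≤ q ⬝ᵥ v - q ⬝ᵥ a := by
  have hs : 0 ≤ r + b := by linarith
  by_cases hpair : ∃ k : Fin 3, (a (k + 1) = 0 ∧ v (k + 1) = 0) ∧ (a (k + 2) = 0 ∧ v (k + 2) = 0)
  · obtain ⟨k, ⟨ha1, hv1⟩, ⟨ha2, hv2⟩⟩ := hpair
    rw [spiralValue_axis ha ha1 ha2, spiralValue_axis hv hv1 hv2]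
    by_cases hk : a k = 0 ∧ v k = 0
    · exact ⟨0, by simp, fun i _ _ => by simp, by simp [hk.1, hk.2]⟩
    · have hp1 : 0 < p₁ := hα0.trans hαp
      have ht0 : 0 < α / p₁ := by positivity
      have ht1 : α / p₁ ≤ 1 := (div_le_one hp1).2 hαp.le
      refine ⟨(α / p₁) • cyc k p₁ p₂ p₃, ?_, fun i hai hvi => ?_, ?_⟩
      · rw [smul_cyc, cyc_dotProduct_self, sum_cyc]
        have : (α / p₁) * (α / p₁) * (p₁ + p₂ + p₃) ≤ 1 * (α / p₁) * (p₁ + p₂ + p₃) := by gcongr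
        linear_combination 2 * this + (α / p₁) * (α / p₁) * hp
      · have hik : i ≠ k := by rintro rfl; exact hk ⟨hai, hvi⟩
        rw [smul_dotProduct, axis_dual_reflection ht ht' k i hik, smul_zero]
      · rw [smul_cyc, cyc_dotProduct, cyc_dotProduct, ha1, ha2, hv1, hv2,
          div_mul_cancel₀ _ hp1.ne']
        linarith
  · obtain ⟨c, hc, hZ⟩ : ∃ c, minCoord v = v c ∧ ∀ i, a i = 0 → v i = 0 → i = c := by
      by_cases hex : ∃ c, a c = 0 ∧ v c = 0
      · obtain ⟨c, hac, hvc⟩ := hex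
        refine ⟨c, by rw [minCoord_eq_zero hv hvc, hvc], fun i hai hvi => ?_⟩
        by_contra hne
        obtain ⟨k, ⟨rfl, rfl⟩ | ⟨rfl, rfl⟩⟩ := exists_pair hne
        · exact hpair ⟨k, ⟨hai, hvi⟩, hac, hvc⟩
        · exact hpair ⟨k, ⟨hac, hvc⟩, hai, hvi⟩
      · obtain ⟨c, hc⟩ := exists_minCoord_eq v
        exact ⟨c, hc, fun i hai hvi => absurd ⟨i, hai, hvi⟩ hex⟩
    refine ⟨cyc c (-((r + b) * α)) α α, ?_, fun i hai hvi => ?_, ?_⟩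
    · rw [cyc_dotProduct_self, sum_cyc]
      exact le_of_eq (by linear_combination α * hα)
    · rw [hZ i hai hvi, cyc_dotProduct_col]
      exact le_of_eq (by ring)
    · rw [spiralValue_eq hc]
      linarith [cyc_dotProduct_le_spiralValue hα0.le hs a c]

/-- Along an axis `p₁ > α` gives strictness. Elsewhere the diagonal point is moved, on the line
tangent to the reflection at face `c`, to its second intersection with the sphere. It lies in the
direction of growing coordinate `c + 2`, because `n₂ < 0`. -/
theorem exists_spiral_strict (hb : 0 ≤ b) (hb1 : b < 1)
    (hα : α * (2 + (r + b) ^ 2) = 2 * (2 - (r + b)))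
    (hn : α - 1 + b * (1 + (r + b) * α) < 0)
    (hp : p₁ * p₁ + p₂ * p₂ + p₃ * p₃ = 2 * (p₁ + p₂ + p₃))
    (ht : p₂ + r * p₃ + b * p₁ = 0) (ht' : p₃ + r * p₁ + b * p₂ = 0) (hαp : α < p₁)
    (w : Fin 3 → ℝ) (hw : 0 ≤ w) (hw0 : w ≠ 0) :
    ∃ q, q ⬝ᵥ q ≤ 2 * ∑ i, q i ∧ (∀ i, w i = 0 → q ⬝ᵥ (circ r b).col i ≤ 0) ∧
      spiralValue α (r + b) w < q ⬝ᵥ w := by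
  by_cases hpair : ∃ k : Fin 3, w (k + 1) = 0 ∧ w (k + 2) = 0
  · obtain ⟨k, h1, h2⟩ := hpair
    have hk : w k ≠ 0 := fun h => hw0 (eq_zero_of_cyclic h h1 h2)
    refine ⟨cyc k p₁ p₂ p₃, ?_, fun i hi => ?_, ?_⟩
    · rw [cyc_dotProduct_self, sum_cyc, hp]
    · exact (axis_dual_reflection ht ht' k i (by rintro rfl; exact hk hi)).le
    · rw [spiralValue_axis hw h1 h2, cyc_dotProduct, h1, h2]
      have := mul_lt_mul_of_pos_right hαp (lt_of_le_of_ne (hw k) (Ne.symm hk))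
      linarith
  · obtain ⟨c, hc⟩ := exists_minCoord_eq w
    set ε := -2 * (α - 1 + b * (1 + (r + b) * α)) / (1 + b ^ 2) with hε
    have hε0 : 0 < ε := div_pos (by linarith) (by positivity)
    have hεe : ε * (1 + b ^ 2) = -2 * (α - 1 + b * (1 + (r + b) * α)) := by
      rw [hε]; field_simp
    have h2 : w c ≤ w (c + 2) := hc ▸ minCoord_le w _
    have h2' : 0 < w (c + 2) := by
      refine lt_of_le_of_ne (hw _) fun h => hpair ?_
      have hc0 : w c = 0 := le_antisymm (h ▸ h2) (hw c)
      exact ⟨c + 1, by rw [(fin_three_add c).1]; exact h.symm, by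
        rw [(fin_three_add c).2.1]; exact hc0⟩
    refine ⟨cyc c (-((r + b) * α) - b * ε) α (α + ε), ?_, fun i hi => ?_, ?_⟩
    · rw [cyc_dotProduct_self, sum_cyc]
      exact le_of_eq (by linear_combination α * hα + ε * hεe)
    · have hic : i = c := by
        by_contra hne
        have hc0 : w c = 0 := le_antisymm (by rw [← hi]; exact hc ▸ minCoord_le w i) (hw c)
        obtain ⟨k, ⟨rfl, rfl⟩ | ⟨rfl, rfl⟩⟩ := exists_pair hne
        · exact hpair ⟨k, hi, hc0⟩
        · exact hpair ⟨k, hc0, hi⟩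
      rw [hic, cyc_dotProduct_col]
      exact le_of_eq (by ring)
    · rw [spiralValue_eq hc, cyc_dotProduct, cyc_dotProduct]
      have h3 : b * w c ≤ b * w (c + 2) := mul_le_mul_of_nonneg_left h2 hb
      have h4 : 0 < ε * (w (c + 2) - b * w c) := mul_pos hε0 (by nlinarith)
      linarith

/-- Finite spirals reach the axes at costs that approach the limiting cost. -/
theorem exists_spiral_reached (hκ : 0 < κ) (hr : 0 ≤ r) (hb : 0 ≤ b)
    (hα : α * (2 + (r + b) ^ 2) = 2 * (2 - (r + b))) (hα0 : 0 < α) {n₁ n₂ : ℝ}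
    (hn₁ : n₁ = α - 1 + r * (1 + (r + b) * α)) (hn₂ : n₂ = α - 1 + b * (1 + (r + b) * α))
    (h₁ : 0 < n₁) (h₂ : n₂ < 0) :
    ∃ M : ℝ, ∀ m : ℕ, ∀ c : Fin 3, ∀ s : ℝ, 0 ≤ s → ∃ T z C,
      IsReached (fun _ => -κ) (circ r b) (cyc c s 0 0) T z C ∧
        C ≤ κ * ((α + (-n₂ / n₁) ^ m * M) * s) := by
  -- `M` is the excess over `α`, in units of `κ`, of the unregulated unit-speed move along an axis,
  -- the case `m = 0`.
  refine ⟨(1 / 2 * ((1 + κ) * (1 + κ) + κ * κ + κ * κ)) / κ - α, fun m => ?_⟩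
  induction m with
  | zero =>
    intro c s hs
    have h := (isReached_zero (θ := fun _ : Fin 3 => -κ) (R := circ r b)).extend (u := cyc c 1 0 0)
      (η := 0) hs le_rfl (fun i hi => absurd rfl hi)
      (by rw [Matrix.mulVec_zero, add_zero, smul_cyc, zero_add]; exact cyc_nonneg (by simpa)
            (by simp) (by simp))
    have e : cyc c 1 0 0 - (fun _ => -κ) = cyc c (1 + κ) κ κ :=
      funext ((forall_cyclic c).2 ⟨by simp, by simp, by simp⟩)
    rw [Matrix.mulVec_zero, add_zero, smul_cyc, zero_add, e, normSq_one, cyc_dotProduct_self] at h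
    simp only [mul_one, mul_zero] at h
    refine ⟨_, _, _, h, le_of_eq ?_⟩
    field_simp
    ring
  | succ m ih =>
    intro c s hs
    have hl : 0 ≤ s / n₁ := by positivity
    have hln : s / n₁ * n₁ = s := by field_simp
    -- The last move crosses face `c + 2` from axis `c + 1` to axis `c`. It adds no excess and
    -- multiplies the distance by `n₁ / -n₂`, so the relative excess shrinks by `-n₂ / n₁`.
    obtain ⟨T, z, C, h, hC⟩ := ih (c + 1) (s / n₁ * -n₂) (mul_nonneg hl (by linarith))
    have e0 : cyc (c + 1) (s / n₁ * -n₂) 0 0 = cyc (c + 2) 0 0 (s / n₁ * -n₂) := by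
      rw [cyc_rotate, cyc_rotate_two]
    have e1 : cyc (c + 2) 0 0 (s / n₁ * -n₂) + (s / n₁) • cyc (c + 2) 0 n₁ n₂ = cyc c s 0 0 := by
      rw [smul_cyc, cyc_add, cyc_rotate_two, hln]
      congr 1 <;> ring
    rw [e0] at h
    have h' := h.faceMove hκ (c := c + 2) (l := s / n₁) (n₁ := n₁) (n₂ := n₂) (q₁ := α) (q₂ := α)
      (q₃ := -((r + b) * α)) (by simp) (by linear_combination α * hα) (by ring)
      (by have : 0 ≤ (r + b) * α := by positivity
          linarith) hl (by rw [hn₁]; ring)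
      (by rw [hn₂]; ring) (by rw [e1]; exact cyc_nonneg hs le_rfl le_rfl)
    rw [e1] at h'
    refine ⟨_, _, _, h', (add_le_add_left hC _).trans (le_of_eq ?_)⟩
    rw [pow_succ]
    field_simp
    ring

/-- If spirals are cheaper than axes, no path with finitely many segments to a point of the
boundary is optimal. -/
theorem not_isOptimalPath_of_one_lt (hκ : 0 < κ) (hb : 0 ≤ b) (hr : 1 < r) (hs : r + b < 2)
    {v : Fin 3 → ℝ} (hv : 0 ≤ v) (hv0 : v ≠ 0) {c : Fin 3} (hc : v c = 0) {z : ℝ → Fin 3 → ℝ}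
    {T : ℝ} {n : ℕ} (h : IsOptimalPath (fun _ => -κ) 1 (circ r b) v T z)
    (hz : HasSegments z T n) : False := by
  obtain ⟨p₁, p₂, p₃, hp, ht, ht', -, -, hsum, -, hα'⟩ :=
    exists_axis_dual hb (by linarith : b < r) hs
  have hr0 : 0 ≤ r := by linarith
  have hb1 : b < 1 := by linarith
  have hD : 0 < 2 + (r + b) ^ 2 := by positivity
  obtain ⟨α, hαdef⟩ : ∃ α, α = 2 * (2 - (r + b)) / (2 + (r + b) ^ 2) := ⟨_, rfl⟩
  have hα : α * (2 + (r + b) ^ 2) = 2 * (2 - (r + b)) := by rw [hαdef]; field_simp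
  have hα0 : 0 < α := by rw [hαdef]; exact div_pos (by linarith) hD
  have hαp : α < p₁ := lt_of_mul_lt_mul_right (hα.trans_lt (hα' hr)) hD.le
  have hn := spiral_normal_neg hb hr hs hα
  obtain ⟨n₁, hn₁⟩ : ∃ n₁, n₁ = α - 1 + r * (1 + (r + b) * α) := ⟨_, rfl⟩
  obtain ⟨n₂, hn₂⟩ : ∃ n₂, n₂ = α - 1 + b * (1 + (r + b) * α) := ⟨_, rfl⟩
  have hn2neg : n₂ < 0 := hn₂ ▸ hn
  -- This makes the ratio `-n₂ / n₁` of successive turns less than `1`.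
  have hn12 : 0 < n₁ + n₂ := by
    have : n₁ + n₂ = 2 - (r + b) := by rw [hn₁, hn₂]; linear_combination hα
    linarith
  have h₁ : 0 < n₁ := by linarith
  obtain ⟨x, y, hf, hopt⟩ := h
  have hlt : κ * spiralValue α (r + b) v < cost (fun _ => -κ) 1 x T := by
    refine (isSubsolution_smul hκ.le fun a b' ha hb' => exists_spiral_admissible hr0 hb hα hα0 hp
      hsum ht ht' hαp a b' ha hb').lt_cost (fun w hw hw0 => ?_) hv0 hf hz
    obtain ⟨q, hq1, hq2, hq3⟩ := exists_spiral_strict hb hb1 hα hn hp ht ht' hαp w hw hw0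
    refine ⟨κ • q, isAdmissible_smul hκ.le hq1 fun i _ hi => hq2 i hi, ?_⟩
    rw [smul_dotProduct]
    exact mul_lt_mul_of_pos_left hq3 hκ
  have hval : spiralValue α (r + b) v = α * (v (c + 1) + v (c + 2)) := by
    rw [spiralValue, minCoord_eq_zero hv hc, sum_cyclic c, hc]; ring
  rw [hopt, hval] at hlt
  obtain ⟨M, hM⟩ := exists_spiral_reached hκ hr0 hb hα hα0 hn₁ hn₂ h₁ hn2neg
  obtain ⟨l, hldef⟩ : ∃ l, l = v (c + 1) / n₁ := ⟨_, rfl⟩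
  have hln : l * n₁ = v (c + 1) := by rw [hldef]; field_simp
  have hl : 0 ≤ l := by rw [hldef]; exact div_nonneg (hv _) h₁.le
  -- The point of axis `c + 2` from which the last move in face `c` hits `v`.
  obtain ⟨s, hsdef⟩ : ∃ s, s = v (c + 2) - l * n₂ := ⟨_, rfl⟩
  have hs0 : 0 ≤ s := by
    have h1 : 0 ≤ l * -n₂ := mul_nonneg hl (by linarith)
    have h2 : 0 ≤ v (c + 2) := hv _
    rw [hsdef]; linarith
  have hbound : ∀ m : ℕ, value (fun _ => -κ) 1 (circ r b) v ≤
      κ * (α * (v (c + 1) + v (c + 2))) + (-n₂ / n₁) ^ m * (κ * (M * s)) := by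
    intro m
    obtain ⟨T', z', C, hR, hC⟩ := hM m (c + 2) s hs0
    have e1 : cyc c 0 0 s + l • cyc c 0 n₁ n₂ = v := by
      rw [smul_cyc, cyc_add, hln, eq_cyc c v]
      simp [hc, hsdef]
    rw [cyc_rotate_two] at hR
    have h' := hR.faceMove hκ (c := c) (l := l) (n₁ := n₁) (n₂ := n₂) (q₁ := α) (q₂ := α)
      (q₃ := -((r + b) * α)) (by simp) (by linear_combination α * hα) (by ring)
      (by have : 0 ≤ (r + b) * α := by positivity
          linarith) hl (by rw [hn₁]; ring)
      (by rw [hn₂]; ring) (by rw [e1]; exact hv)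
    rw [e1] at h'
    refine h'.value_le.trans ((add_le_add_left hC _).trans (le_of_eq ?_))
    rw [hsdef]
    linear_combination κ * α * hln
  have hlim : Filter.Tendsto (fun m : ℕ => κ * (α * (v (c + 1) + v (c + 2))) +
      (-n₂ / n₁) ^ m * (κ * (M * s))) Filter.atTop
      (nhds (κ * (α * (v (c + 1) + v (c + 2))) + 0 * (κ * (M * s)))) := by
    refine ((tendsto_pow_atTop_nhds_zero_of_lt_one (div_nonneg (by linarith) h₁.le) ?_).mul_const
      _).const_add _
    rw [div_lt_one h₁]; linarith
  have := ge_of_tendsto' hlim hbound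
  linarith

end Spiral

/-! ### The case `r ≤ 1`: an axial segment, then possibly one in a face. -/

section Direct

variable {r b κ p₁ p₂ p₃ : ℝ}

/-- The maximum of the linear functionals of the three axes. -/
noncomputable def axisValue (p₁ p₂ p₃ : ℝ) (z : Fin 3 → ℝ) : ℝ :=
  Finset.univ.sup' Finset.univ_nonempty fun k => cyc k p₁ p₂ p₃ ⬝ᵥ z

theorem le_axisValue (p₁ p₂ p₃ : ℝ) (z : Fin 3 → ℝ) (k : Fin 3) :
    cyc k p₁ p₂ p₃ ⬝ᵥ z ≤ axisValue p₁ p₂ p₃ z :=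
  Finset.le_sup' (fun k => cyc k p₁ p₂ p₃ ⬝ᵥ z) (Finset.mem_univ k)

theorem axisValue_zero : axisValue p₁ p₂ p₃ 0 = 0 := by
  simp [axisValue]

/-- The maximum is attained at an axis along which the point has a positive coordinate. -/
theorem exists_axisValue_eq (h₂ : p₂ ≤ p₁) (h₃ : p₃ ≤ p₁) {z : Fin 3 → ℝ} (hz : 0 ≤ z)
    (hz0 : z ≠ 0) : ∃ j, axisValue p₁ p₂ p₃ z = cyc j p₁ p₂ p₃ ⬝ᵥ z ∧ z j ≠ 0 := by
  obtain ⟨j, -, hj⟩ := Finset.exists_mem_eq_sup' Finset.univ_nonempty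
    fun k => cyc k p₁ p₂ p₃ ⬝ᵥ z
  change axisValue p₁ p₂ p₃ z = _ at hj
  by_cases hzj : z j = 0
  · have hle1 := le_axisValue p₁ p₂ p₃ z (j + 1)
    have hle2 := le_axisValue p₁ p₂ p₃ z (j + 2)
    have e0 : cyc j p₁ p₂ p₃ ⬝ᵥ z = p₂ * z (j + 1) + p₃ * z (j + 2) := by
      rw [cyc_dotProduct, hzj]; ring
    have e1 : cyc (j + 1) p₁ p₂ p₃ ⬝ᵥ z = p₁ * z (j + 1) + p₂ * z (j + 2) := by
      rw [cyc_rotate, cyc_dotProduct, hzj]; ring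
    have e2 : cyc (j + 2) p₁ p₂ p₃ ⬝ᵥ z = p₃ * z (j + 1) + p₁ * z (j + 2) := by
      rw [cyc_rotate_two, cyc_dotProduct, hzj]; ring
    have n1 : 0 ≤ z (j + 1) := hz _
    have n2 : 0 ≤ z (j + 2) := hz _
    have m21 := mul_le_mul_of_nonneg_right h₂ n1
    have m32 := mul_le_mul_of_nonneg_right h₃ n2
    by_cases hz1 : z (j + 1) = 0
    · refine ⟨j + 2, le_antisymm ?_ hle2, fun hz2 => hz0 (eq_zero_of_cyclic hzj hz1 hz2)⟩
      rw [hj, e0, e2, hz1]; linarith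
    · by_cases hz2 : z (j + 2) = 0
      · refine ⟨j + 1, le_antisymm ?_ hle1, hz1⟩
        rw [hj, e0, e1, hz2]; linarith
      · rcases le_total p₂ p₃ with h23 | h23
        · refine ⟨j + 2, le_antisymm ?_ hle2, hz2⟩
          have := mul_le_mul_of_nonneg_right h23 n1
          rw [hj, e0, e2]; linarith
        · refine ⟨j + 1, le_antisymm ?_ hle1, hz1⟩
          have := mul_le_mul_of_nonneg_right h23 n2
          rw [hj, e0, e1]; linarith
  · exact ⟨j, hj, hzj⟩

theorem exists_pos_of_ne_zero {z : Fin 3 → ℝ} (hz0 : z ≠ 0) : ∃ k, z k ≠ 0 := by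
  by_contra! h
  exact hz0 (funext h)

/-- The lower bound for the cost near the face `z c = 0`: `h` and `g` are the functionals of the
paths that enter the face from its two axes. -/
theorem exists_face_admissible (h₂ : p₂ ≤ p₁) (h₃ : p₃ ≤ p₁)
    (hp : p₁ * p₁ + p₂ * p₂ + p₃ * p₃ = 2 * (p₁ + p₂ + p₃))
    (ht : p₂ + r * p₃ + b * p₁ = 0) (ht' : p₃ + r * p₁ + b * p₂ = 0)
    {h g : Fin 3 → ℝ} (hh : h ⬝ᵥ h ≤ 2 * ∑ i, h i) (hg : g ⬝ᵥ g ≤ 2 * ∑ i, g i) {c : Fin 3}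
    (hhc : h ⬝ᵥ (circ r b).col c ≤ 0) (hgc : g ⬝ᵥ (circ r b).col c ≤ 0)
    (hh₁ : h (c + 1) ≤ p₁) (hh₃ : h c ≤ p₃) (hg₂ : g (c + 2) ≤ p₁) (hg₃ : g c ≤ p₂)
    (a v : Fin 3 → ℝ) (hv : 0 ≤ v) :
    ∃ q, q ⬝ᵥ q ≤ 2 * ∑ i, q i ∧ (∀ i, a i = 0 → v i = 0 → q ⬝ᵥ (circ r b).col i ≤ 0) ∧
      max (min (h ⬝ᵥ v) (g ⬝ᵥ v)) (axisValue p₁ p₂ p₃ v) -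
        max (min (h ⬝ᵥ a) (g ⬝ᵥ a)) (axisValue p₁ p₂ p₃ a) ≤ q ⬝ᵥ v - q ⬝ᵥ a := by
  have hpk : ∀ k : Fin 3, cyc k p₁ p₂ p₃ ⬝ᵥ cyc k p₁ p₂ p₃ ≤ 2 * ∑ i, cyc k p₁ p₂ p₃ i :=
    fun k => by rw [cyc_dotProduct_self, sum_cyc, hp]
  have hpc : ∀ k i : Fin 3, i ≠ k → cyc k p₁ p₂ p₃ ⬝ᵥ (circ r b).col i ≤ 0 := fun k i hik =>
    (axis_dual_reflection ht ht' k i hik).le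
  rcases le_or_gt (min (h ⬝ᵥ v) (g ⬝ᵥ v)) (axisValue p₁ p₂ p₃ v) with hle | hlt
  · rw [max_eq_right hle]
    by_cases hv0 : v = 0
    · by_cases ha0 : a = 0
      · exact ⟨0, by simp, fun i _ _ => by simp, by simp [hv0, ha0, axisValue_zero]⟩
      · obtain ⟨k, hk⟩ := exists_pos_of_ne_zero ha0
        refine ⟨cyc k p₁ p₂ p₃, hpk k, fun i hai _ => hpc k i (by rintro rfl; exact hk hai), ?_⟩
        rw [hv0, axisValue_zero, dotProduct_zero]
        linarith [(le_axisValue p₁ p₂ p₃ a k).trans (le_max_right (min (h ⬝ᵥ a) (g ⬝ᵥ a)) _)]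
    · obtain ⟨k, hk, hvk⟩ := exists_axisValue_eq h₂ h₃ hv hv0
      refine ⟨cyc k p₁ p₂ p₃, hpk k, fun i _ hvi => hpc k i (by rintro rfl; exact hvk hvi), ?_⟩
      linarith [(le_axisValue p₁ p₂ p₃ a k).trans (le_max_right (min (h ⬝ᵥ a) (g ⬝ᵥ a)) _)]
  -- If `v (c + 1)` or `v (c + 2)` vanishes, `g` or `h` is dominated at `v` by an axis functional,
  -- contrary to `hlt`.
  · have hZ : ∀ i, v i = 0 → i = c := by
      have n0 : 0 ≤ v c := hv _
      have n1 : 0 ≤ v (c + 1) := hv _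
      have n2 : 0 ≤ v (c + 2) := hv _
      refine (forall_cyclic c).2 ⟨fun _ => rfl, fun hv1 => ?_, fun hv2 => ?_⟩ <;>
        refine absurd hlt (not_lt.2 ?_)
      · refine (min_le_right _ _).trans (le_trans ?_ (le_axisValue p₁ p₂ p₃ v (c + 2)))
        rw [dotProduct_cyclic c, cyc_rotate_two, cyc_dotProduct, hv1]
        linarith [mul_le_mul_of_nonneg_right hg₂ n2, mul_le_mul_of_nonneg_right hg₃ n0]
      · refine (min_le_left _ _).trans (le_trans ?_ (le_axisValue p₁ p₂ p₃ v (c + 1)))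
        rw [dotProduct_cyclic c, cyc_rotate, cyc_dotProduct, hv2]
        linarith [mul_le_mul_of_nonneg_right hh₁ n1, mul_le_mul_of_nonneg_right hh₃ n0]
    rw [max_eq_left hlt.le]
    have hmax := le_max_left (min (h ⬝ᵥ a) (g ⬝ᵥ a)) (axisValue p₁ p₂ p₃ a)
    -- The functional attaining the minimum at `a` works, as the minimum at `v` is at most its value
    -- there.
    rcases le_total (h ⬝ᵥ a) (g ⬝ᵥ a) with hag | hag
    · refine ⟨h, hh, fun i _ hi => by rw [hZ i hi]; exact hhc, ?_⟩
      rw [min_eq_left hag] at hmax ⊢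
      linarith [min_le_left (h ⬝ᵥ v) (g ⬝ᵥ v)]
    · refine ⟨g, hg, fun i _ hi => by rw [hZ i hi]; exact hgc, ?_⟩
      rw [min_eq_right hag] at hmax ⊢
      linarith [min_le_right (h ⬝ᵥ v) (g ⬝ᵥ v)]

/-- A single segment reaches a point of an axis at the cost given by the dual vertex. -/
theorem exists_axis_reached (hκ : 0 < κ) (hrb : r * b < 1)
    (hp : p₁ * p₁ + p₂ * p₂ + p₃ * p₃ = 2 * (p₁ + p₂ + p₃)) (hsum : 0 < p₁ + p₂ + p₃)
    (hp₁ : 0 < p₁) (ht : p₂ + r * p₃ + b * p₁ = 0) (ht' : p₃ + r * p₁ + b * p₂ = 0)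
    (he₂ : 0 < (1 - p₂) - b * (1 - p₃)) (he₃ : 0 < (1 - p₃) - r * (1 - p₂)) (k : Fin 3) {s : ℝ}
    (hs : 0 < s) : ∃ T U z, 0 < T ∧ 0 < U ∧ (∀ t ∈ Icc 0 T, z t = t • cyc k U 0 0) ∧
      IsReached (fun _ => -κ) (circ r b) (cyc k s 0 0) T z (κ * (p₁ * s)) := by
  have hD : 0 < 1 - r * b := by linarith
  -- Cramer's rule for the pushes that keep both other coordinates at zero.
  obtain ⟨η₂, hη₂⟩ : ∃ x, x = ((1 - p₂) - b * (1 - p₃)) / (1 - r * b) := ⟨_, rfl⟩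
  obtain ⟨η₃, hη₃⟩ : ∃ x, x = ((1 - p₃) - r * (1 - p₂)) / (1 - r * b) := ⟨_, rfl⟩
  have hη₂0 : 0 ≤ η₂ := by rw [hη₂]; exact (div_pos he₂ hD).le
  have hη₃0 : 0 ≤ η₃ := by rw [hη₃]; exact (div_pos he₃ hD).le
  have hη₂D : η₂ * (1 - r * b) = (1 - p₂) - b * (1 - p₃) := by rw [hη₂, div_mul_cancel₀ _ hD.ne']
  have hη₃D : η₃ * (1 - r * b) = (1 - p₃) - r * (1 - p₂) := by rw [hη₃, div_mul_cancel₀ _ hD.ne']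
  have eq2 : p₂ - 1 + η₂ + b * η₃ = 0 :=
    mul_right_cancel₀ hD.ne' (by linear_combination hη₂D + b * hη₃D)
  have eq3 : p₃ - 1 + η₃ + r * η₂ = 0 :=
    mul_right_cancel₀ hD.ne' (by linear_combination hη₃D + r * hη₂D)
  obtain ⟨w, hw⟩ : ∃ w, w = p₁ - 1 + b * η₂ + r * η₃ := ⟨_, rfl⟩
  have hpw : p₁ * w = p₁ + p₂ + p₃ := by
    rw [hw]
    linear_combination hp - p₂ * eq2 - p₃ * eq3 + η₂ * ht + η₃ * ht'
  have hw0 : 0 < w := pos_of_mul_pos_right (hpw ▸ hsum) hp₁.le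
  have hlw : s / w * w = s := by field_simp
  have h := (isReached_zero (θ := fun _ : Fin 3 => -κ) (R := circ r b)).move hκ
    (q := cyc k p₁ p₂ p₃) (η := cyc k 0 η₂ η₃) (w := cyc k w 0 0) (l := s / w)
    (by rw [cyc_dotProduct_self, sum_cyc, hp]) (cyc_nonneg le_rfl hη₂0 hη₃0) ?_ ?_ (by positivity)
    (by rw [zero_add, smul_cyc]; exact cyc_nonneg (by positivity) (by simp) (by simp))
  · rw [zero_add, zero_add, zero_add, smul_cyc, smul_cyc, hlw, mul_zero, mul_zero, cyc_dotProduct,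
      cyc_zero, cyc_one, cyc_two, mul_zero, mul_zero, add_zero, add_zero] at h
    refine ⟨s / w / κ, κ * w, _, by positivity, by positivity, fun t ht => ?_, h⟩
    rw [extend_of_mem (by rwa [zero_add]), zero_add, sub_zero]
  · rw [circ_mulVec_cyc]
    refine funext ((forall_cyclic k).2 ⟨?_, ?_, ?_⟩)
    · simp [hw]; ring
    · simp; linarith
    · simp; linarith
  · refine (forall_cyclic k).2 ⟨fun h => absurd (by simp) h, fun _ => ⟨rfl, by simp, ?_⟩,
      fun _ => ⟨rfl, by simp, ?_⟩⟩
    · rw [cyc_dotProduct_col_one, ht]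
    · rw [cyc_dotProduct_col_two, ht']

/-- Continuing an axial segment by a segment in the interior of the face `z c = 0`. -/
theorem exists_gradual_two (hκ : 0 < κ) {c : Fin 3} {T C s₁ s₂ U₁ U₂ l q₁ q₂ q₃ : ℝ}
    {z : ℝ → Fin 3 → ℝ} (hT : 0 < T) (hz : ∀ t ∈ Icc 0 T, z t = t • cyc c 0 U₁ U₂)
    (h : IsReached (fun _ => -κ) (circ r b) (cyc c 0 s₁ s₂) T z C)
    (hU₁ : 0 ≤ U₁) (hU₂ : 0 ≤ U₂) (K : Finset (Fin 3)) (hK : K.card = 2)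
    (hKU : ∀ i ∈ K, cyc c 0 U₁ U₂ i = 0) (hKU' : ∀ i ∉ K, 0 < cyc c 0 U₁ U₂ i)
    (hq : q₁ * q₁ + q₂ * q₂ + q₃ * q₃ = 2 * (q₁ + q₂ + q₃)) (hq' : q₃ + r * q₁ + b * q₂ = 0)
    (hq₃ : q₃ ≤ 1) (hl : 0 < l) {n₁ n₂ : ℝ} (hn₁ : n₁ = q₁ - 1 + r * (1 - q₃))
    (hn₂ : n₂ = q₂ - 1 + b * (1 - q₃)) (hn : 0 < n₁ ∨ 0 < n₂) {v : Fin 3 → ℝ}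
    (hv₁ : 0 < v (c + 1)) (hv₂ : 0 < v (c + 2))
    (hv : cyc c 0 s₁ s₂ + l • cyc c 0 n₁ n₂ = v) :
    ∃ z' T', IsReached (fun _ => -κ) (circ r b) v T' z' (C + κ * (l * (q₁ * n₁ + q₂ * n₂))) ∧
      IsGradual z' T' 2 := by
  have hv0 : v c = 0 := by rw [← hv]; simp
  have hvn : 0 ≤ v := (forall_cyclic c).2 ⟨hv0.ge, hv₁.le, hv₂.le⟩
  have hzT : T • cyc c 0 U₁ U₂ = cyc c 0 s₁ s₂ := by
    obtain ⟨x, y, hf, -⟩ := h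
    rw [← hf.terminal, hz T ⟨hT.le, le_rfl⟩]
  have h' := h.faceMove hκ (c := c) (by simp) hq hq' hq₃ hl.le hn₁ hn₂ (by rw [hv]; exact hvn)
  rw [hv] at h'
  have hδ : 0 < l / κ := by positivity
  have hend : T • cyc c 0 U₁ U₂ + (l / κ) • κ • cyc c 0 n₁ n₂ = v := by
    rw [hzT, smul_smul, div_mul_cancel₀ _ hκ.ne', hv]
  refine ⟨_, _, h', isGradual_two hT hδ (u₁ := cyc c 0 U₁ U₂) (u₂ := κ • cyc c 0 n₁ n₂)
    (fun t ht => ?_) (fun t ht => ?_) (fun h0 => ?_) (fun h0 => ?_) K {c} hKU hKU' (fun i hi => ?_)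
    (fun i hi => ?_) (by rw [hK, Finset.card_singleton]; norm_num)⟩
  · rw [extend_of_le ht.2, hz t ht]
  · rw [extend_of_mem ht, hz T ⟨hT.le, le_rfl⟩]
  · obtain ⟨i, hi⟩ : ∃ i, i ∉ K := by
      by_contra! hall
      have : K = Finset.univ := Finset.eq_univ_of_forall hall
      rw [this] at hK
      simp at hK
    exact (hKU' i hi).ne' (congrFun h0 i)
  · rcases hn with hn | hn
    · have := congrFun h0 (c + 1)
      simp [hκ.ne', hn.ne'] at this
    · have := congrFun h0 (c + 2)
      simp [hκ.ne', hn.ne'] at this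
  · rw [Finset.mem_singleton.1 hi]; simp
  · rw [hend]
    revert hi
    exact (forall_cyclic c (P := fun i => i ∉ ({c} : Finset (Fin 3)) →
      0 ≤ cyc c 0 U₁ U₂ i ∧ 0 < v i)).2 ⟨fun h => absurd (Finset.mem_singleton_self c) h,
        fun _ => ⟨by simpa, hv₁⟩, fun _ => ⟨by simpa, hv₂⟩⟩ i

/-- Start from the dual points of axes `c + 1` and `c + 2` and move along the tangent directions
`(-b, 0, 1)` and `(-r, 1, 0)` of face `c`; `x` and `y` lead back to the sphere. The new functionals
keep the slope `p₁` on their own axes. -/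
theorem le_value_of_hasSegments (hκ : 0 < κ) (hb : 0 ≤ b) (hr : 0 ≤ r) (h₂ : p₂ ≤ p₁)
    (h₃ : p₃ ≤ p₁) (hp : p₁ * p₁ + p₂ * p₂ + p₃ * p₃ = 2 * (p₁ + p₂ + p₃))
    (ht : p₂ + r * p₃ + b * p₁ = 0) (ht' : p₃ + r * p₁ + b * p₂ = 0) {x y : ℝ} (hx0 : 0 ≤ x)
    (hy0 : 0 ≤ y) (hx : (1 + b ^ 2) * x = 2 * ((1 - p₂) - b * (1 - p₃)))
    (hy : (1 + r ^ 2) * y = 2 * ((1 - p₃) - r * (1 - p₂))) (c : Fin 3) {v : Fin 3 → ℝ}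
    {z : ℝ → Fin 3 → ℝ} {T : ℝ} {n : ℕ} (h : IsOptimalPath (fun _ => -κ) 1 (circ r b) v T z)
    (hz : HasSegments z T n) :
    κ * max (min (cyc c (p₃ - b * x) p₁ (p₂ + x) ⬝ᵥ v) (cyc c (p₂ - r * y) (p₃ + y) p₁ ⬝ᵥ v))
      (axisValue p₁ p₂ p₃ v) ≤ value (fun _ => -κ) 1 (circ r b) v := by
  have hbx := mul_nonneg hb hx0
  have hry := mul_nonneg hr hy0
  refine (isSubsolution_smul hκ.le fun a w _ hw => exists_face_admissible (c := c) h₂ h₃ hp ht ht'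
    (h := cyc c (p₃ - b * x) p₁ (p₂ + x)) (g := cyc c (p₂ - r * y) (p₃ + y) p₁) ?_ ?_ ?_ ?_ ?_ ?_
    ?_ ?_ a w hw).le_value (by simp [axisValue_zero]) h hz
  · rw [cyc_dotProduct_self, sum_cyc]
    exact le_of_eq (by linear_combination hp + x * hx)
  · rw [cyc_dotProduct_self, sum_cyc]
    exact le_of_eq (by linear_combination hp + y * hy)
  · rw [cyc_dotProduct_col]
    exact le_of_eq (by linear_combination ht')
  · rw [cyc_dotProduct_col]
    exact le_of_eq (by linear_combination ht)
  · simp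
  · simpa using hbx
  · simp
  · simpa using hry

/-- For `r ≤ 1` an optimal path to a point of an axis is a single segment. -/
theorem exists_axis_optimal (hκ : 0 < κ) (hb : 0 ≤ b) (hbr : b < r) (hr : r ≤ 1)
    {k : Fin 3} {v : Fin 3 → ℝ} (hv : 0 < v k) (hv₁ : v (k + 1) = 0) (hv₂ : v (k + 2) = 0)
    {z : ℝ → Fin 3 → ℝ} {T : ℝ} {n : ℕ} (h : IsOptimalPath (fun _ => -κ) 1 (circ r b) v T z)
    (hz : HasSegments z T n) :
    ∃ z' T', IsOptimalPath (fun _ => -κ) 1 (circ r b) v T' z' ∧ IsGradual z' T' 1 := by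
  have hr0 : 0 ≤ r := by linarith
  have hrb : r * b < 1 := (mul_le_of_le_one_left hb hr).trans_lt (by linarith)
  obtain ⟨p₁, p₂, p₃, hp, ht, ht', hp₁, hp₃, hsum, hdir, -⟩ :=
    exists_axis_dual hb hbr (by linarith)
  obtain ⟨h₂, he₂, he₃, -, -⟩ := hdir hr
  obtain ⟨T', U, z', hT', hU, hz', hR⟩ := exists_axis_reached hκ hrb hp
    hsum hp₁ ht ht' he₂ he₃ k hv
  have hvk : cyc k (v k) 0 0 = v := by
    have := eq_cyc k v
    rw [hv₁, hv₂] at this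
    exact this.symm
  rw [hvk] at hR
  have hb2 : 0 < 1 + b ^ 2 := by positivity
  have hr2 : 0 < 1 + r ^ 2 := by positivity
  have hle := le_value_of_hasSegments hκ hb hr0 h₂ (by linarith) hp ht ht'
    (x := 2 * ((1 - p₂) - b * (1 - p₃)) / (1 + b ^ 2))
    (y := 2 * ((1 - p₃) - r * (1 - p₂)) / (1 + r ^ 2)) (by positivity) (by positivity)
    (by field_simp) (by field_simp) k h hz
  refine ⟨z', T', hR.isOptimalPath (le_trans ?_ hle), isGradual_one hT' hz' (fun h0 => ?_)
    {k + 1, k + 2} (fun i hi => ?_) fun i hi => ?_⟩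
  · refine mul_le_mul_of_nonneg_left (le_trans ?_ (le_max_right _ _)) hκ.le
    refine le_trans ?_ (le_axisValue p₁ p₂ p₃ v k)
    rw [cyc_dotProduct, hv₁, hv₂]; linarith
  · have := congrFun h0 k
    simp [hU.ne'] at this
  · rcases Finset.mem_insert.1 hi with rfl | hi
    · simp
    · rw [Finset.mem_singleton.1 hi]; simp
  · revert hi
    exact (forall_cyclic k (P := fun i => i ∉ ({k + 1, k + 2} : Finset (Fin 3)) →
      0 < cyc k U 0 0 i)).2 ⟨fun _ => by simpa, fun hi => absurd (by simp) hi,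
        fun hi => absurd (by simp) hi⟩ i

/-- For `r ≤ 1` an optimal path to a point of a face runs along an axis first. -/
theorem exists_face_optimal (hκ : 0 < κ) (hb : 0 ≤ b) (hbr : b < r) (hr : r ≤ 1)
    {c : Fin 3} {v : Fin 3 → ℝ} (hv : v c = 0) (hv₁ : 0 < v (c + 1)) (hv₂ : 0 < v (c + 2))
    {z : ℝ → Fin 3 → ℝ} {T : ℝ} {n : ℕ} (h : IsOptimalPath (fun _ => -κ) 1 (circ r b) v T z)
    (hz : HasSegments z T n) :
    ∃ z' T', IsOptimalPath (fun _ => -κ) 1 (circ r b) v T' z' ∧ IsGradual z' T' 2 := by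
  have hr0 : 0 ≤ r := by linarith
  have hrb : r * b < 1 := (mul_le_of_le_one_left hb hr).trans_lt (by linarith)
  obtain ⟨p₁, p₂, p₃, hp, ht, ht', hp₁, hp₃, hsum, hdir, -⟩ :=
    exists_axis_dual hb hbr (by linarith)
  obtain ⟨h₂, he₂, he₃, hlt, hle⟩ := hdir hr
  have hb2 : 0 < 1 + b ^ 2 := by positivity
  have hr2 : 0 < 1 + r ^ 2 := by positivity
  obtain ⟨x, hxdef⟩ : ∃ x, x = 2 * ((1 - p₂) - b * (1 - p₃)) / (1 + b ^ 2) := ⟨_, rfl⟩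
  obtain ⟨y, hydef⟩ : ∃ y, y = 2 * ((1 - p₃) - r * (1 - p₂)) / (1 + r ^ 2) := ⟨_, rfl⟩
  have hx : (1 + b ^ 2) * x = 2 * ((1 - p₂) - b * (1 - p₃)) := by rw [hxdef]; field_simp
  have hy : (1 + r ^ 2) * y = 2 * ((1 - p₃) - r * (1 - p₂)) := by rw [hydef]; field_simp
  have hx0 : 0 ≤ x := by rw [hxdef]; positivity
  have hy0 : 0 ≤ y := by rw [hydef]; positivity
  have hB : 0 < p₂ + x - p₁ := by
    have := lt_of_mul_lt_mul_left (hx ▸ hlt) hb2.le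
    linarith
  have hA : 0 ≤ p₃ + y - p₁ := by
    have := le_of_mul_le_mul_left (hy ▸ hle) hr2
    linarith
  have hval := le_value_of_hasSegments hκ hb hr0 h₂ (by linarith) hp ht ht' hx0 hy0 hx hy c h hz
  replace hval := (mul_le_mul_of_nonneg_left (le_max_left _ (axisValue p₁ p₂ p₃ v)) hκ.le).trans
    hval
  rw [cyc_dotProduct, cyc_dotProduct, hv] at hval
  have hh : p₁ * p₁ + (p₂ + x) * (p₂ + x) + (p₃ - b * x) * (p₃ - b * x) =
      2 * (p₁ + (p₂ + x) + (p₃ - b * x)) := by linear_combination hp + x * hx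
  have hg : (p₃ + y) * (p₃ + y) + p₁ * p₁ + (p₂ - r * y) * (p₂ - r * y) =
      2 * ((p₃ + y) + p₁ + (p₂ - r * y)) := by linear_combination hp + y * hy
  have hh' : (p₃ - b * x) + r * p₁ + b * (p₂ + x) = 0 := by linear_combination ht'
  have hg' : (p₂ - r * y) + r * (p₃ + y) + b * p₁ = 0 := by linear_combination ht
  have hsep := sphere_separation hh hg hh' hg'
  have hsep' := sphere_separation hg hh hg' hh'
  have hBsq := pow_pos hB 2
  have hbx := mul_nonneg hb hx0
  have hry := mul_nonneg hr0 hy0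
  have hp21 : p₂ ≤ 1 := by
    by_contra! hcon
    have h1 : 0 < b * (1 - p₃) + (p₂ - 1) := by
      have := mul_nonneg hb (by linarith : 0 ≤ 1 - p₃)
      linarith
    linarith
  -- The smaller functional at `v` determines the axis of the first segment.
  rcases le_total (p₁ * v (c + 1) + (p₂ + x) * v (c + 2)) ((p₃ + y) * v (c + 1) + p₁ * v (c + 2))
    with hcase | hcase
  · rw [min_eq_left (by linarith)] at hval
    obtain ⟨n₁, hn₁⟩ : ∃ n₁, n₁ = p₁ - 1 + r * (1 - (p₃ - b * x)) := ⟨_, rfl⟩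
    obtain ⟨n₂, hn₂⟩ : ∃ n₂, n₂ = p₂ + x - 1 + b * (1 - (p₃ - b * x)) := ⟨_, rfl⟩
    have hn2 : 0 < n₂ := by
      have : n₂ = (1 - p₂) - b * (1 - p₃) := by rw [hn₂]; linear_combination hx
      rw [this]; exact he₂
    rw [← hn₁, ← hn₂] at hsep
    obtain ⟨l, hl⟩ : ∃ l, l = v (c + 2) / n₂ := ⟨_, rfl⟩
    have hln : l * n₂ = v (c + 2) := by rw [hl]; field_simp
    have hl0 : 0 < l := by rw [hl]; positivity
    -- The backward ray from `v` meets the axis at a positive height: `hsep` says that `n` strictly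
    -- separates the two dual points, and `hcase` compares them at `v`.
    have hs : 0 < v (c + 1) - l * n₁ := by
      have h1 : 0 < (p₂ + x - p₁) * n₂ - (p₃ + y - p₁) * n₁ := by
        have := sq_nonneg (p₁ - (p₃ + y))
        have := sq_nonneg (p₃ - b * x - (p₂ - r * y))
        linarith
      have h2 := mul_pos hl0 h1
      have h3 : 0 < (p₃ + y - p₁) * (v (c + 1) - l * n₁) := by
        linear_combination h2 + hcase + (p₂ + x - p₁) * hln
      exact pos_of_mul_pos_right h3 hA
    obtain ⟨T₁, U, z₁, hT₁, hU, hz₁, hR⟩ := exists_axis_reached hκ hrb hp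
      hsum hp₁ ht ht' he₂ he₃ (c + 1) hs
    rw [cyc_rotate] at hR
    simp only [cyc_rotate] at hz₁
    have hK : ∀ i ∈ ({c, c + 2} : Finset (Fin 3)), cyc c 0 U 0 i = 0 := by simp
    have hK' : ∀ i ∉ ({c, c + 2} : Finset (Fin 3)), 0 < cyc c 0 U 0 i :=
      (forall_cyclic c).2 ⟨fun hi => absurd (by simp) hi, fun _ => by simpa,
        fun hi => absurd (by simp) hi⟩
    have hend : cyc c 0 (v (c + 1) - l * n₁) 0 + l • cyc c 0 n₁ n₂ = v := by
      have e := eq_cyc c v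
      rw [hv] at e
      rw [smul_cyc, cyc_add, hln, e]
      simp
    obtain ⟨z', T', hR', hgrad⟩ := exists_gradual_two hκ hT₁ hz₁ hR hU.le le_rfl {c, c + 2}
      (by simp) hK hK' hh hh' (by linarith) hl0 hn₁ hn₂ (Or.inr hn2) hv₁ hv₂ hend
    refine ⟨z', T', hR'.isOptimalPath (le_trans (le_of_eq ?_) hval), hgrad⟩
    linear_combination κ * (p₂ + x) * hln
  · rw [min_eq_right (by linarith)] at hval
    obtain ⟨n₁, hn₁⟩ : ∃ n₁, n₁ = p₃ + y - 1 + r * (1 - (p₂ - r * y)) := ⟨_, rfl⟩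
    obtain ⟨n₂, hn₂⟩ : ∃ n₂, n₂ = p₁ - 1 + b * (1 - (p₂ - r * y)) := ⟨_, rfl⟩
    have hn1 : 0 < n₁ := by
      have : n₁ = (1 - p₃) - r * (1 - p₂) := by rw [hn₁]; linear_combination hy
      rw [this]; exact he₃
    rw [← hn₁, ← hn₂] at hsep'
    obtain ⟨l, hl⟩ : ∃ l, l = v (c + 1) / n₁ := ⟨_, rfl⟩
    have hln : l * n₁ = v (c + 1) := by rw [hl]; field_simp
    have hl0 : 0 < l := by rw [hl]; positivity
    have hs : 0 < v (c + 2) - l * n₂ := by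
      have h1 : 0 < (p₃ + y - p₁) * n₁ - (p₂ + x - p₁) * n₂ := by
        have := sq_nonneg (p₃ + y - p₁)
        have := sq_nonneg (p₂ - r * y - (p₃ - b * x))
        linarith
      have h2 := mul_pos hl0 h1
      have h3 : 0 < (p₂ + x - p₁) * (v (c + 2) - l * n₂) := by
        linear_combination h2 + hcase + (p₃ + y - p₁) * hln
      exact pos_of_mul_pos_right h3 hB.le
    obtain ⟨T₁, U, z₁, hT₁, hU, hz₁, hR⟩ := exists_axis_reached hκ hrb hp
      hsum hp₁ ht ht' he₂ he₃ (c + 2) hs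
    rw [cyc_rotate_two] at hR
    simp only [cyc_rotate_two] at hz₁
    have hK : ∀ i ∈ ({c, c + 1} : Finset (Fin 3)), cyc c 0 0 U i = 0 := by simp
    have hK' : ∀ i ∉ ({c, c + 1} : Finset (Fin 3)), 0 < cyc c 0 0 U i :=
      (forall_cyclic c).2 ⟨fun hi => absurd (by simp) hi, fun hi => absurd (by simp) hi,
        fun _ => by simpa⟩
    have hend : cyc c 0 0 (v (c + 2) - l * n₂) + l • cyc c 0 n₁ n₂ = v := by
      have e := eq_cyc c v
      rw [hv] at e
      rw [smul_cyc, cyc_add, hln, e]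
      simp
    obtain ⟨z', T', hR', hgrad⟩ := exists_gradual_two hκ hT₁ hz₁ hR le_rfl hU.le {c, c + 1}
      (by simp) hK hK' hg hg' (by linarith) hl0 hn₁ hn₂ (Or.inl hn1) hv₁ hv₂ hend
    refine ⟨z', T', hR'.isOptimalPath (le_trans (le_of_eq ?_) hval), hgrad⟩
    linear_combination κ * (p₃ + y) * hln

end Direct

end SRBM

/-! ### The theorem, by cases on `r₁ ≤ 1`. -/

theorem mainTheorem5 (θ₀ r₁ r₂ : ℝ) (θ : Fin 3 → ℝ) (Γ R : Matrix (Fin 3) (Fin 3) ℝ)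
    (hsym : SRBM.IsRotationallySymmetric θ₀ r₁ r₂ θ Γ R) (hΓ : Γ = 1) (hθ : θ₀ < 0)
    (hr₁ : 0 ≤ r₁) (hr₂ : 0 ≤ r₂) (hC : SRBM.Condition1 r₁ r₂) :
    (∀ K : Finset (Fin 3), K.card = 2 → ∀ v ∈ SRBM.face K, v ≠ 0 →
      (∃ (z : ℝ → Fin 3 → ℝ) (T : ℝ) (n : ℕ),
        SRBM.IsOptimalPath θ Γ R v T z ∧ SRBM.HasSegments z T n) →
      ∃ (z : ℝ → Fin 3 → ℝ) (T : ℝ),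
        SRBM.IsOptimalPath θ Γ R v T z ∧ SRBM.HasSegments z T 1) ∧
    (∀ K : Finset (Fin 3), K.card = 1 → ∀ v ∈ SRBM.face K, v ≠ 0 →
      (∃ (z : ℝ → Fin 3 → ℝ) (T : ℝ) (n : ℕ),
        SRBM.IsOptimalPath θ Γ R v T z ∧ SRBM.HasSegments z T n) →
      ∃ (z : ℝ → Fin 3 → ℝ) (T : ℝ) (n : ℕ), (n = 1 ∨ n = 2) ∧
        SRBM.IsOptimalPath θ Γ R v T z ∧ SRBM.IsGradual z T n) := by
  obtain ⟨⟨-, -, hlt, -, hsum⟩, -⟩ := hC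
  change r₂ < r₁ at hlt
  change r₁ + r₂ < 2 at hsum
  have hκ : 0 < -θ₀ := by linarith
  have hθ' : θ = fun _ => -(-θ₀) := by
    rw [hsym.drift]
    ext i
    fin_cases i <;> simp
  have hR : R = SRBM.circ r₁ r₂ := hsym.reflection
  rw [hθ', hR, hΓ]
  refine ⟨?_, ?_⟩
  · rintro K hK v ⟨hv, hvK⟩ hv0 ⟨z, T, n, hopt, hseg⟩
    have hpair : ∀ K : Finset (Fin 3), K.card = 2 → ∃ k : Fin 3, k + 1 ∈ K ∧ k + 2 ∈ K := by
      decide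
    obtain ⟨k, hk1, hk2⟩ := hpair K hK
    have hv1 := hvK _ hk1
    have hv2 := hvK _ hk2
    have hvk : v k ≠ 0 := fun h => hv0 (SRBM.eq_zero_of_cyclic h hv1 hv2)
    rcases le_or_gt r₁ 1 with hr | hr
    · obtain ⟨z', T', h1, h2⟩ := SRBM.exists_axis_optimal hκ hr₂ hlt hr
        (lt_of_le_of_ne (hv k) (Ne.symm hvk)) hv1 hv2 hopt hseg
      exact ⟨z', T', h1, h2.hasSegments⟩
    · exact (SRBM.not_isOptimalPath_of_one_lt hκ hr₂ hr hsum hv hv0 hv1 hopt hseg).elim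
  · rintro K hK v ⟨hv, hvK⟩ hv0 ⟨z, T, n, hopt, hseg⟩
    obtain ⟨c, rfl⟩ := Finset.card_eq_one.1 hK
    have hvc := hvK c (Finset.mem_singleton_self c)
    rcases le_or_gt r₁ 1 with hr | hr
    · obtain ⟨f1, f2, f3, f4⟩ := SRBM.fin_three_add c
      -- Faces are closed, so `v` may lie on an axis.
      by_cases h1 : v (c + 1) = 0
      · have h2 : v (c + 2) ≠ 0 := fun h => hv0 (SRBM.eq_zero_of_cyclic hvc h1 h)
        obtain ⟨z', T', h3, h4⟩ := SRBM.exists_axis_optimal (k := c + 2) hκ hr₂ hlt hr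
          (lt_of_le_of_ne (hv _) (Ne.symm h2)) (by rwa [f3]) (by rwa [f4]) hopt hseg
        exact ⟨z', T', 1, Or.inl rfl, h3, h4⟩
      · by_cases h2 : v (c + 2) = 0
        · obtain ⟨z', T', h3, h4⟩ := SRBM.exists_axis_optimal (k := c + 1) hκ hr₂ hlt hr
            (lt_of_le_of_ne (hv _) (Ne.symm h1)) (by rwa [f1]) (by rwa [f2]) hopt hseg
          exact ⟨z', T', 1, Or.inl rfl, h3, h4⟩
        · obtain ⟨z', T', h3, h4⟩ := SRBM.exists_face_optimal hκ hr₂ hlt hr hvc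
            (lt_of_le_of_ne (hv _) (Ne.symm h1)) (lt_of_le_of_ne (hv _) (Ne.symm h2)) hopt hseg
          exact ⟨z', T', 2, Or.inr rfl, h3, h4⟩
    · exact (SRBM.not_isOptimalPath_of_one_lt hκ hr₂ hr hsum hv hv0 hvc hopt hseg).elim
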